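/- **Function spaces.** Let $\Delta=\{(u,v):0\le v\le u\}$ with the $L^1$ metric. For $\alpha\ge 0$ let $\mathcal B(\alpha)$ be the set of $\alpha$-Lipschitz $\psi:\Delta\to[0,\infty)$ with $\psi(u,u)=0$, $\psi(u,v)\le\psi(u,w)+\psi(w,v)$ for $0\le v\le w\le u$, increasing in $u$ and decreasing in $v$. Let $\mathcal G(\alpha)$ be the set of decreasing $\alpha$-Lipschitz $\gamma:[0,1]\to[0,\infty)$ with $\gamma(1)=0$ and $\gamma(\lambda\theta)\le\gamma(\theta)+\theta\gamma(\lambda)$ for $\lambda,\theta\in[0,1]$. For $0\le h\le\alpha$ let $\overline{\mathcal B}_h(\alpha)$ be the set of $\psi\in\mathcal B(\alpha)$ with $\psi(u+z,v+z)\ge\psi(u,v)$ for $z\ge0$ and $\psi(u,0)-\psi(v,0)\ge h(u-v)$ for all $(u,v)\in\Delta$, and let $\overline{\mathcal G}_h(\alpha)$ be the set of $\gamma\in\mathcal G(\alpha)$ such that $\gamma(0)\ge h$ and $\theta\mapsto\gamma(\theta)/(1-\theta)$ is increasing on $[0,1)$. Put $$\Gamma(\psi)(\theta)=\limsup_{u\to\infty}\frac{\psi(u,\theta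 u)}{u},\qquad \Psi(\gamma)(\theta)=\frac{\gamma(\theta)}{1-\theta}\ \ (\theta<1),\quad \Psi(\gamma)(1)=\lim_{\theta\nearrow1}\frac{\gamma(\theta)}{1-\theta},$$ $$\Omega_h(\gamma)(\theta)=(1-\theta)\max\Bigl\{h,\max_{0\le\lambda\le\theta}\Psi(\gamma)(\lambda)\Bigr\},\qquad \Phi_h(\psi)(u,v)=\max_{0\le z\le u}\begin{cases}\psi(u-z,v-z)&: 0\le z\le v,\\ h(z-v)+\psi(u-z,0)&: v\le z\le u.\end{cases}$$ **Metric notions.** For a non-empty metric space $E$ let $N_r(A)$ be the least number of open balls of $E$ of radius $r$ covering $A\subset E$, let $\beta_E(u,v)=\log_2\sup_{x\in E}N_{2^{-u}}(B(x,2^{-v}))$ and, for $0\le\theta<1$, $$\dim_{\mathrm A}^{\theta}E=\limsup_{u\to\infty}\frac{\beta_E(u,\theta u)}{u(1-\theta)},\qquad \overline{\dim}_{\mathrm A}^{\theta}E=\limsup_{u\to\infty}\sup_{0\le\lambda\le\theta}\frac{\beta_E(u,\lambda u)}{u(1-\lambda)}.$$ The quasi-Assouad dimension $\dim_{\mathrm{qA}}E$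 is the limit as $\theta\nearrow1$ of the infimum of the $s\ge0$ for which there is $C>0$ such that $N_r(B(x,R))\le C(R/r)^s$ for all $x\in E$ and $0<r\le r^\theta\le R<1$. An error function is an increasing $\eta:[0,\infty)\to[0,\infty)$ with $\eta(u)/u\to0$ as $u\to\infty$; $E$ has approximate branching function $\psi$ if $|\beta_E(u,v)-\psi(u,v)|\le\eta(u)$ on $\Delta$ for some error function $\eta$. **Inhomogeneous systems.** Let $X$ be a compact metric space with $\dim_{\mathrm{qA}}X=\alpha<\infty$, let $\{f_i\}_{i\in\mathcal I}$ be a finite non-empty family of strict contractions of $X$, let $F\subset X$ be non-empty and compact, and let $\Lambda$ be the inhomogeneous attractor, i.e. the non-empty compact set with $\Lambda=F\cup\bigcup_i f_i(\Lambda)$. Let $\mathcal I^*$ be the set of finite words on $\mathcal I$ and $f_w=f_{i_1}\circ\dots\circ f_{i_n}$ for $w=(i_1,\dots,i_n)$. Assume that the system is minimally distorting: there are $\rho:\mathcal I^*\to[0,\infty)$, an error function $\eta$ and constants $A,C\geq 0$ such that $\rho(\varnothing)=0$, $\rho(w)>0$ for $w\ne\varnothing$, $0\le\rho(ww')-\rho(w)-\rho(w')\le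 A$ for all $w,w'\in\mathcal I^*$, and for every $w\in\mathcal I^*$ $$\operatorname{diam}f_w(X)\le C\,2^{-\rho(w)},\qquad |\beta_{f_w(F)}(u+\rho(w),v+\rho(w))-\beta_F(u,v)|\le\eta(u+\rho(w))\quad\text{for all }(u,v)\in\Delta .$$ Write $w^-$ for $w$ without its last letter, and put $\mathcal I^*(u)=\{w:\rho(w^-)<u\le\rho(w)\}$. Assume that the system is asymptotically bounded: $\lim_{u\to\infty}u^{-1}\log_2\sup_{x\in X}\#\{w\in\mathcal I^*(u):f_w(X)\cap B(x,2^{-u})\ne\varnothing\}=0$. **Theorem E.** 1. Let $0\le h\le\alpha$. Then $\Gamma$ maps $\mathcal B(\alpha)$ into $\mathcal G(\alpha)$ and $\overline{\mathcal B}_h(\alpha)$ into $\overline{\mathcal G}_h(\alpha)$, $\Phi_h$ maps $\mathcal B(\alpha)$ into $\overline{\mathcal B}_h(\alpha)$, and $\Omega_h$ maps $\mathcal G(\alpha)$ into $\overline{\mathcal G}_h(\alpha)$. For $\gamma\in\mathcal G(\alpha)$, $\Omega_h(\gamma)$ is the least $\xi\in\overline{\mathcal G}_h(\alpha)$ with $\xi\ge\gamma$;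 the map $\Omega_h:\mathcal G(\alpha)\to\overline{\mathcal G}_h(\alpha)$ is surjective, idempotent, and the identity on $\overline{\mathcal G}_h(\alpha)$. The restriction $\Gamma:\overline{\mathcal B}_h(\alpha)\to\overline{\mathcal G}_h(\alpha)$ is surjective. Finally $\Gamma\circ\Phi_h=\Omega_h\circ\Gamma$ on $\mathcal B(\alpha)$. 2. In the setting above, the critical exponent $h=\lim_{u\to\infty}u^{-1}\log_2\#\mathcal I^*(u)$ exists, $0\le h\le\alpha$, and for all $0\le\theta<1$ $$\dim_{\mathrm A}^{\theta}\Lambda=\max\{h,\overline{\dim}_{\mathrm A}^{\theta}F\}.$$ Moreover, if $\psi\in\mathcal B(\alpha)$ is any approximate branching function of $F$, then $\dim_{\mathrm A}^{\theta}\Lambda=\Psi(\Gamma(\Phi_h(\psi)))(\theta)=\Psi(\Omega_h(\Gamma(\psi)))(\theta)$ for all $0\le\theta<1$. -/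

import Mathlib

open Set Filter Topology
open scoped ENNReal NNReal

noncomputable section

/-! ### Spaces of two-scale branching functions

A function on `Δ = {(u, v) : 0 ≤ v ≤ u}` is represented by a function `ℝ → ℝ → ℝ` of which only
the values on `Δ` matter, and a function on `[0, 1]` by a function `ℝ → ℝ` of which only the values
on `[0, 1]` matter. -/

/-- The space `𝓑(α)`, `α ≥ 0`: the `α`-Lipschitz (for the `L¹` metric on `Δ`) two-scale branching
functions. Since `ψ (u, u) = 0`, a Lipschitz function with values in `[0, ∞]` is finite, so real
values lose nothing. -/
structure IsBranching (α : ℝ) (ψ : ℝ → ℝ → ℝ) : Prop where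
  nonneg : ∀ u v, 0 ≤ v → v ≤ u → 0 ≤ ψ u v
  diag : ∀ u, 0 ≤ u → ψ u u = 0
  subadd : ∀ u w v, 0 ≤ v → v ≤ w → w ≤ u → ψ u v ≤ ψ u w + ψ w v
  mono_left : ∀ u w v, 0 ≤ v → v ≤ w → w ≤ u → ψ w v ≤ ψ u v
  anti_right : ∀ u w v, 0 ≤ v → v ≤ w → w ≤ u → ψ u w ≤ ψ u v
  lipschitz : ∀ u v u' v', 0 ≤ v → v ≤ u → 0 ≤ v' → v' ≤ u' →
    |ψ u v - ψ u' v'| ≤ α * (|u - u'| + |v - v'|)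

/-- The monotone subspace `𝓑̄_h(α)` of `𝓑(α)`. -/
structure IsMonoBranching (h α : ℝ) (ψ : ℝ → ℝ → ℝ) : Prop extends IsBranching α ψ where
  diag_mono : ∀ u v z, 0 ≤ v → v ≤ u → 0 ≤ z → ψ u v ≤ ψ (u + z) (v + z)
  growth : ∀ u v, 0 ≤ v → v ≤ u → h * (u - v) ≤ ψ u 0 - ψ v 0

/-- The space `𝓖(α)`, `α ≥ 0`. -/
structure IsLimitFun (α : ℝ) (γ : ℝ → ℝ) : Prop where
  nonneg : ∀ θ ∈ Icc (0 : ℝ) 1, 0 ≤ γ θ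
  at_one : γ 1 = 0
  anti : AntitoneOn γ (Icc 0 1)
  subadd : ∀ lam ∈ Icc (0 : ℝ) 1, ∀ θ ∈ Icc (0 : ℝ) 1, γ (lam * θ) ≤ γ θ + θ * γ lam
  lipschitz : ∀ s ∈ Icc (0 : ℝ) 1, ∀ t ∈ Icc (0 : ℝ) 1, |γ s - γ t| ≤ α * |s - t|

/-- The monotone subspace `𝓖̄_h(α)` of `𝓖(α)`. -/
structure IsMonoLimitFun (h α : ℝ) (γ : ℝ → ℝ) : Prop extends IsLimitFun α γ where
  mono : MonotoneOn (fun θ => γ θ / (1 - θ)) (Ico 0 1)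
  le_at_zero : h ≤ γ 0

/-- The normalized limit `Γ(ψ)(θ) = limsup_{u → ∞} ψ(u, θ u) / u`. -/
def GammaLim (ψ : ℝ → ℝ → ℝ) (θ : ℝ) : ℝ :=
  limsup (fun u : ℝ => ψ u (θ * u) / u) atTop

/-- `Φ_h(ψ)(u, v)`: the maximum over `0 ≤ z ≤ u` of `ψ(u - z, v - z)` (for `z ≤ v`) and
`h (z - v) + ψ(u - z, 0)` (for `z ≥ v`; the two expressions agree at `z = v`). -/
def PhiProj (h : ℝ) (ψ : ℝ → ℝ → ℝ) (u v : ℝ) : ℝ :=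
  sSup ((fun z : ℝ => if z ≤ v then ψ (u - z) (v - z) else h * (z - v) + ψ (u - z) 0) '' Icc 0 u)

/-- `Ψ(γ)(θ) = γ(θ) / (1 - θ)` for `θ < 1`, extended to `θ = 1` by its left limit. -/
def PsiQuot (γ : ℝ → ℝ) (θ : ℝ) : ℝ :=
  if θ < 1 then γ θ / (1 - θ) else limUnder (𝓝[<] (1 : ℝ)) (fun t : ℝ => γ t / (1 - t))

/-- `Ω_h(γ)(θ) = (1 - θ) · max {h, max_{0 ≤ λ ≤ θ} Ψ(γ)(λ)}`. -/
def OmegaProj (h : ℝ) (γ : ℝ → ℝ) (θ : ℝ) : ℝ :=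
  (1 - θ) * max h (sSup (PsiQuot γ '' Icc 0 θ))

/-! ### Branching functions and dimensions of metric spaces -/

/-- `N_r(A)`: the least number of open balls of radius `r` of the metric space `E` that cover
`A`. -/
def coverNum {E : Type*} [MetricSpace E] (r : ℝ) (A : Set E) : ℕ∞ :=
  ⨅ (C : Set E) (_ : A ⊆ ⋃ c ∈ C, Metric.ball c r), C.encard

/-- Logarithm in base `2` of an extended natural number that is at least `1`. -/
def log2 (n : ℕ∞) : ℝ≥0∞ :=
  (ENNReal.log (n : ℝ≥0∞)).toENNReal / ENNReal.ofReal (Real.log 2)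

/-- The two-scale branching function `β_E(u, v) = log₂ sup_{x ∈ E} N_{2^{-u}}(B(x, 2^{-v}))`. -/
def branching (E : Type*) [MetricSpace E] (u v : ℝ) : ℝ≥0∞ :=
  log2 (⨆ x : E, coverNum ((2 : ℝ) ^ (-u)) (Metric.ball x ((2 : ℝ) ^ (-v))))

/-- The Assouad spectrum at `0 ≤ θ < 1`. -/
def assouadSpectrum (E : Type*) [MetricSpace E] (θ : ℝ) : ℝ≥0∞ :=
  limsup (fun u : ℝ => branching E u (θ * u) / ENNReal.ofReal (u * (1 - θ))) atTop

/-- The upper Assouad spectrum at `0 ≤ θ < 1`. -/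
def upperAssouadSpectrum (E : Type*) [MetricSpace E] (θ : ℝ) : ℝ≥0∞ :=
  limsup (fun u : ℝ => ⨆ lam ∈ Icc (0 : ℝ) θ,
    branching E u (lam * u) / ENNReal.ofReal (u * (1 - lam))) atTop

/-- The quasi-Assouad dimension. The quantity under the limit is monotone in `θ`, so that the upper
limit is a limit. -/
def quasiAssouadDim (E : Type*) [MetricSpace E] : ℝ≥0∞ :=
  limsup (fun θ : ℝ => ⨅ (s : ℝ≥0) (_ : ∃ C : ℝ, 0 < C ∧ ∀ r R : ℝ, 0 < r → r ≤ r ^ θ → r ^ θ ≤ R →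
    R < 1 → ∀ x : E, (coverNum r (Metric.ball x R) : ℝ≥0∞) ≤
      ENNReal.ofReal (C * (R / r) ^ (s : ℝ))), (s : ℝ≥0∞)) (𝓝[<] (1 : ℝ))

/-- Error functions: increasing functions `[0, ∞) → [0, ∞)` that are `o(u)`. -/
structure IsErrorFun (η : ℝ → ℝ) : Prop where
  nonneg : ∀ u, 0 ≤ u → 0 ≤ η u
  mono : MonotoneOn η (Ici 0)
  tendsto : Tendsto (fun u => η u / u) atTop (𝓝 0)

/-- `E` has approximate two-scale branching function `ψ`, that is, `β_E(u, v) = ψ(u, v) + o(u)` on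
`Δ`. -/
def HasApproxBranching (E : Type*) [MetricSpace E] (ψ : ℝ → ℝ → ℝ) : Prop :=
  ∃ η : ℝ → ℝ, IsErrorFun η ∧ ∀ u v : ℝ, 0 ≤ v → v ≤ u →
    branching E u v ≤ ENNReal.ofReal (ψ u v) + ENNReal.ofReal (η u) ∧
    ENNReal.ofReal (ψ u v) ≤ branching E u v + ENNReal.ofReal (η u)

/-! ### Inhomogeneous iterated function systems -/

/-- `f_w = f_{i₁} ∘ ⋯ ∘ f_{iₙ}` for the word `w = (i₁, …, iₙ)`. -/
def wordMap {X ι : Type*} (f : ι → X → X) : List ι → X → X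
  | [] => id
  | i :: w => f i ∘ wordMap f w

/-- `Λ` is the inhomogeneous attractor of `(f i)` with condensation set `F`: the (unique) non-empty
compact set with `Λ = F ∪ ⋃ i, f i (Λ)`. -/
structure IsInhomAttractor {X ι : Type*} [MetricSpace X] (f : ι → X → X) (F Λ : Set X) : Prop where
  nonempty : Λ.Nonempty
  isCompact : IsCompact Λ
  invariant : Λ = F ∪ ⋃ i, f i '' Λ

/-- The system `(f i)` of contractions of `X` is minimally distorting, with respect to the weight
`ρ` on finite words, for the condensation set `F`. The condition `uniform` compares `β_F` with the
branching function of `f_w(F)` carrying the metric `2^{ρ(w)} d`; that branching function is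
`(u, v) ↦ β_{f_w(F)}(u + ρ(w), v + ρ(w))`. The condition `diam_le` is the requirement that `f_w`
contracts at scale `2^{-ρ(w)}`. -/
structure MinimallyDistorting {X ι : Type*} [MetricSpace X] (f : ι → X → X) (F : Set X)
    (ρ : List ι → ℝ) : Prop where
  nil : ρ [] = 0
  pos : ∀ w : List ι, w ≠ [] → 0 < ρ w
  almost_additive : ∃ A : ℝ, 0 ≤ A ∧ ∀ w w' : List ι,
    0 ≤ ρ (w ++ w') - (ρ w + ρ w') ∧ ρ (w ++ w') - (ρ w + ρ w') ≤ A
  diam_le : ∃ C : ℝ, ∀ (w : List ι) (x y : X),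
    dist (wordMap f w x) (wordMap f w y) ≤ C * (2 : ℝ) ^ (-ρ w)
  uniform : ∃ η : ℝ → ℝ, IsErrorFun η ∧ ∀ (w : List ι) (u v : ℝ), 0 ≤ v → v ≤ u →
    branching (wordMap f w '' F) (u + ρ w) (v + ρ w) ≤
      branching F u v + ENNReal.ofReal (η (u + ρ w)) ∧
    branching F u v ≤
      branching (wordMap f w '' F) (u + ρ w) (v + ρ w) + ENNReal.ofReal (η (u + ρ w))

/-- `𝓘*(u)`, the words `w` with `ρ(w⁻) < u ≤ ρ(w)`, where `w⁻` is `w` without its last letter. -/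
def wordsAt {ι : Type*} (ρ : List ι → ℝ) (u : ℝ) : Set (List ι) :=
  {w | ρ w.dropLast < u ∧ u ≤ ρ w}

/-- `𝓕(x, u)`, the words `w ∈ 𝓘*(u)` such that `f_w(X)` meets `B(x, 2^{-u})`. -/
def wordsNear {X ι : Type*} [MetricSpace X] (f : ι → X → X) (ρ : List ι → ℝ) (x : X) (u : ℝ) :
    Set (List ι) :=
  {w ∈ wordsAt ρ u | (range (wordMap f w) ∩ Metric.ball x ((2 : ℝ) ^ (-u))).Nonempty}

/-- `h` is the critical exponent, `h = lim_{u → ∞} log₂ #𝓘*(u) / u`. -/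
def IsCriticalExponent {ι : Type*} (ρ : List ι → ℝ) (h : ℝ) : Prop :=
  Tendsto (fun u : ℝ => Real.logb 2 ((wordsAt ρ u).ncard : ℝ) / u) atTop (𝓝 h)

/-- The system is asymptotically bounded: `log₂ sup_{x ∈ X} #𝓕(x, u) = o(u)`. -/
def AsymptoticallyBounded {X ι : Type*} [MetricSpace X] (f : ι → X → X) (ρ : List ι → ℝ) : Prop :=
  Tendsto (fun u : ℝ => Real.logb 2 (⨆ x : X, ((wordsNear f ρ x u).ncard : ℝ)) / u) atTop (𝓝 0)

end

/-!
The first part is a chain of estimates between functions on `Δ` and on `[0, 1]`. Translating a pair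
`(u, s u)` along the diagonal until it reaches the angle `t ≥ s` keeps the difference `u - v`; this
is why monotonicity along diagonals turns into monotonicity of `γ(θ) / (1 - θ)`
(`IsMonoBranching.isMonoLimitFun_gammaLim`). The projection `Φ_h` is the supremum over diagonal
translates of an extension of `ψ` with slope `h` below `v = 0` (`negExtension`), and `Ω_h γ` is
visibly the least monotone majorant. In the identity `Γ ∘ Φ_h = Ω_h ∘ Γ` one inequality is this
minimality; the other needs that the upper limit defining `Γ(ψ)(θ)` is attained uniformly in `θ`
(`IsBranching.eventually_forall_le_gammaLim`), since `Φ_h` takes a supremum over angles. A section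
of `Γ` is given by the homogeneous functions `(u, v) ↦ u ξ(v / u)`.

For the second part, the number of words cut off at weight `u` is submultiplicative up to a
constant, so the critical exponent `h` exists by Fekete's lemma, and the Poincaré series
`∑ 2 ^ (-H ρ(w))` converges for `H > h` (`WordWeight.tsum_twoPow_ne_top`). Asymptotic boundedness
says that only `2 ^ o(u)` cylinders of size `2 ^ (-u)` meet a ball of that radius; comparing with
covers of `X` gives `h ≤ α`.

The spectrum of `Λ` at the angle `θ` is bounded below by the upper spectrum of `F`, because a copy
`f_w(F) ⊆ Λ` with a suitable weight moves any pair of scales of `F` at an angle at most `θ` to the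
angle `θ` (`upperAssouadSpectrum_le_assouadSpectrum`), and by `h`, because a cylinder of size
`2 ^ (-θ u)` contains about `2 ^ (h (1 - θ) u)` essentially separated cylinders of size `2 ^ (-u)`
(`critical_exponent_le_assouadSpectrum`). For the upper bound (`branching_attractor_le`), the part
of `Λ` in a ball of radius `2 ^ (-θ u)` consists of copies of `F` larger than the ball, which are
few and see the ball at an angle at most `θ`, and of smaller copies of `F` and cylinders of size
`2 ^ (-u)`. A copy of weight `r` contributes at most `2 ^ (H (u - r) + o(u))` balls whenever `H`
exceeds the upper spectrum of `F`, and when `H` also exceeds `h` the sum over all copies is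
controlled by the Poincaré series.

Covering numbers are compared with `2 ^ t` in `[0, ∞]` (`twoPow`), which makes infinite sums over
words unproblematic; errors `o(u)` appear as `ε u + K` with `K` depending on `ε`.
-/

/-! ### The normalized limit `Γ` -/

theorem mul_mem_of_angle {θ u : ℝ} (hθ : θ ∈ Icc (0 : ℝ) 1) (hu : 0 ≤ u) : 0 ≤ θ * u ∧ θ * u ≤ u :=
  ⟨mul_nonneg hθ.1 hu, by nlinarith [hθ.2]⟩

namespace IsBranching

variable {α : ℝ} {ψ : ℝ → ℝ → ℝ}

theorem le_mul_sub (hψ : IsBranching α ψ) {u v : ℝ} (hv : 0 ≤ v) (hvu : v ≤ u) :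
    ψ u v ≤ α * (u - v) := by
  have h := hψ.lipschitz u v u u hv hvu (hv.trans hvu) le_rfl
  rw [hψ.diag u (hv.trans hvu), sub_self, abs_zero, zero_add, sub_zero, abs_sub_comm v u,
    abs_of_nonneg (sub_nonneg.2 hvu)] at h
  exact (le_abs_self _).trans h

theorem isBoundedUnder (hψ : IsBranching α ψ) {θ : ℝ} (hθ : θ ∈ Icc (0 : ℝ) 1) :
    IsBoundedUnder (· ≤ ·) atTop (fun u : ℝ => ψ u (θ * u) / u) := by
  refine isBoundedUnder_of_eventually_le (a := α * (1 - θ)) ?_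
  filter_upwards [eventually_gt_atTop 0] with u hu
  have h := mul_mem_of_angle hθ hu.le
  rw [div_le_iff₀ hu]
  linarith [hψ.le_mul_sub h.1 h.2]

theorem isCoboundedUnder (hψ : IsBranching α ψ) {θ : ℝ} (hθ : θ ∈ Icc (0 : ℝ) 1) :
    IsCoboundedUnder (· ≤ ·) atTop (fun u : ℝ => ψ u (θ * u) / u) := by
  refine IsBoundedUnder.isCoboundedUnder_le (isBoundedUnder_of_eventually_ge (a := 0) ?_)
  filter_upwards [eventually_gt_atTop 0] with u hu
  have h := mul_mem_of_angle hθ hu.le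
  exact div_nonneg (hψ.nonneg _ _ h.1 h.2) hu.le

theorem gammaLim_le (hψ : IsBranching α ψ) {θ c : ℝ} (hθ : θ ∈ Icc (0 : ℝ) 1)
    (h : ∀ ε > 0, ∀ᶠ u in atTop, ψ u (θ * u) ≤ (c + ε) * u) : GammaLim ψ θ ≤ c := by
  refine le_of_forall_pos_le_add fun ε hε => limsup_le_of_le (hψ.isCoboundedUnder hθ) ?_
  filter_upwards [h ε hε, eventually_gt_atTop 0] with u hu hu0
  rwa [div_le_iff₀ hu0]

theorem le_gammaLim (hψ : IsBranching α ψ) {θ c : ℝ} (hθ : θ ∈ Icc (0 : ℝ) 1)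
    (h : ∃ᶠ u in atTop, c * u ≤ ψ u (θ * u)) : c ≤ GammaLim ψ θ := by
  refine le_limsup_of_frequently_le ?_ (hψ.isBoundedUnder hθ)
  refine (h.and_eventually (eventually_gt_atTop 0)).mono fun u hu => ?_
  rw [le_div_iff₀ hu.2]
  exact hu.1

theorem eventually_le_gammaLim (hψ : IsBranching α ψ) {θ ε : ℝ} (hθ : θ ∈ Icc (0 : ℝ) 1)
    (hε : 0 < ε) : ∀ᶠ u in atTop, ψ u (θ * u) ≤ (GammaLim ψ θ + ε) * u := by
  have h := eventually_lt_of_limsup_lt (lt_add_of_pos_right (GammaLim ψ θ) hε)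
    (hψ.isBoundedUnder hθ)
  filter_upwards [h, eventually_gt_atTop 0] with u hu hu0
  exact ((div_lt_iff₀ hu0).1 hu).le

theorem frequently_gammaLim_le (hψ : IsBranching α ψ) {θ ε : ℝ} (hθ : θ ∈ Icc (0 : ℝ) 1)
    (hε : 0 < ε) : ∃ᶠ u in atTop, (GammaLim ψ θ - ε) * u ≤ ψ u (θ * u) := by
  have h := frequently_lt_of_lt_limsup (hψ.isCoboundedUnder hθ) (sub_lt_self (GammaLim ψ θ) hε)
  refine (h.and_eventually (eventually_gt_atTop 0)).mono fun u hu => ?_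
  exact ((lt_div_iff₀ hu.2).1 hu.1).le

theorem gammaLim_le_gammaLim {α' : ℝ} {ψ' : ℝ → ℝ → ℝ} (hψ : IsBranching α ψ)
    (hψ' : IsBranching α' ψ') {θ : ℝ} (hθ : θ ∈ Icc (0 : ℝ) 1)
    (h : ∀ u, 0 ≤ u → ψ u (θ * u) ≤ ψ' u (θ * u)) : GammaLim ψ θ ≤ GammaLim ψ' θ := by
  refine hψ.gammaLim_le hθ fun ε hε => ?_
  filter_upwards [hψ'.eventually_le_gammaLim hθ hε, eventually_ge_atTop 0] with u hu hu0
  exact (h u hu0).trans hu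

/-- Each condition on `Γ(ψ)` is the limit of one on `ψ`; subadditivity comes from the intermediate
scale `θ u`, as `ψ(u, λ θ u) ≤ ψ(u, θ u) + ψ(θ u, λ θ u)`. -/
theorem isLimitFun_gammaLim (hψ : IsBranching α ψ) : IsLimitFun α (GammaLim ψ) := by
  have key : ∀ s ∈ Icc (0 : ℝ) 1, ∀ t ∈ Icc (0 : ℝ) 1,
      GammaLim ψ s ≤ GammaLim ψ t + α * |s - t| := fun s hs t ht => by
    refine hψ.gammaLim_le hs fun ε hε => ?_
    filter_upwards [hψ.eventually_le_gammaLim ht hε, eventually_ge_atTop 0] with u hu hu0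
    have hs' := mul_mem_of_angle hs hu0
    have ht' := mul_mem_of_angle ht hu0
    have h := (le_abs_self _).trans (hψ.lipschitz u (s * u) u (t * u) hs'.1 hs'.2 ht'.1 ht'.2)
    rw [sub_self, abs_zero, zero_add, ← sub_mul, abs_mul, abs_of_nonneg hu0] at h
    linarith
  refine ⟨fun θ hθ => ?_, le_antisymm ?_ ?_, fun s hs t ht hst => ?_,
    fun lam hlam θ hθ => ?_, fun s hs t ht => ?_⟩
  · refine hψ.le_gammaLim hθ (Eventually.frequently ?_)
    filter_upwards [eventually_ge_atTop 0] with u hu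
    rw [zero_mul]
    exact hψ.nonneg _ _ (mul_mem_of_angle hθ hu).1 (mul_mem_of_angle hθ hu).2
  · refine hψ.gammaLim_le (right_mem_Icc.2 zero_le_one) fun ε hε => ?_
    filter_upwards [eventually_ge_atTop 0] with u hu
    rw [one_mul, hψ.diag u hu]
    positivity
  · refine hψ.le_gammaLim (right_mem_Icc.2 zero_le_one) (Eventually.frequently ?_)
    filter_upwards [eventually_ge_atTop 0] with u hu
    rw [one_mul, hψ.diag u hu, zero_mul]
  · refine hψ.gammaLim_le ht fun ε hε => ?_
    filter_upwards [hψ.eventually_le_gammaLim hs hε, eventually_ge_atTop 0] with u hu hu0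
    exact (hψ.anti_right u _ _ (mul_mem_of_angle hs hu0).1 (mul_le_mul_of_nonneg_right hst hu0)
      (mul_mem_of_angle ht hu0).2).trans hu
  · have hm : lam * θ ∈ Icc (0 : ℝ) 1 := ⟨mul_nonneg hlam.1 hθ.1, mul_le_one₀ hlam.2 hθ.1 hθ.2⟩
    refine hψ.gammaLim_le hm fun ε hε => ?_
    rcases hθ.1.eq_or_lt with h0 | h0
    · subst h0
      filter_upwards [hψ.eventually_le_gammaLim hθ hε] with u hu
      simpa using hu
    · have h1 := (tendsto_id.const_mul_atTop h0).eventually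
        (hψ.eventually_le_gammaLim hlam (half_pos hε))
      filter_upwards [hψ.eventually_le_gammaLim hθ (half_pos hε), h1, eventually_ge_atTop 0]
        with u hu hu1 hu0
      have hθu := mul_mem_of_angle hθ hu0
      have hlu := mul_mem_of_angle hlam hθu.1
      have h2 := hψ.subadd u (θ * u) (lam * (θ * u)) hlu.1 hlu.2 hθu.2
      simp only [id] at hu1
      rw [mul_assoc]
      nlinarith [mul_nonneg hε.le (sub_nonneg.2 hθu.2)]
  · rw [abs_sub_le_iff]
    have h1 := key s hs t ht
    have h2 := key t ht s hs
    rw [abs_sub_comm] at h2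
    constructor <;> linarith

end IsBranching

theorem IsMonoBranching.isMonoLimitFun_gammaLim {h α : ℝ} {ψ : ℝ → ℝ → ℝ}
    (hψ : IsMonoBranching h α ψ) : IsMonoLimitFun h α (GammaLim ψ) := by
  have hb := hψ.toIsBranching
  refine ⟨hb.isLimitFun_gammaLim, fun s hs t ht hst => ?_, ?_⟩
  · have hs1 : 0 < 1 - s := by linarith [hs.2]
    have ht1 : 0 < 1 - t := by linarith [ht.2]
    simp only
    rw [div_le_iff₀ hs1]
    refine hb.gammaLim_le ⟨hs.1, hs.2.le⟩ fun ε hε => ?_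
    -- The pair `(u, s u)` is translated along the diagonal to the pair `(c u, t c u)`.
    set c := (1 - s) / (1 - t) with hc
    have hcpos : 0 < c := div_pos hs1 ht1
    have hc1 : c * (1 - t) = 1 - s := div_mul_cancel₀ _ ht1.ne'
    have h1 := (tendsto_id.const_mul_atTop hcpos).eventually
      (hb.eventually_le_gammaLim ⟨ht.1, ht.2.le⟩ (div_pos hε hcpos))
    filter_upwards [h1, eventually_ge_atTop 0] with u hu hu0
    have hmem := mul_mem_of_angle (θ := s) ⟨hs.1, hs.2.le⟩ hu0
    have hz : 0 ≤ (c - 1) * u := mul_nonneg (by rw [sub_nonneg, hc, one_le_div ht1]; linarith) hu0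
    have h2 := hψ.diag_mono u (s * u) ((c - 1) * u) hmem.1 hmem.2 hz
    have e1 : u + (c - 1) * u = c * u := by ring
    have e2 : s * u + (c - 1) * u = t * (c * u) := by linear_combination u * hc1
    rw [e1, e2] at h2
    refine h2.trans (hu.trans_eq ?_)
    simp only [id]
    rw [← hc1]
    field_simp
  · refine hb.le_gammaLim (left_mem_Icc.2 zero_le_one) (Eventually.frequently ?_)
    filter_upwards [eventually_ge_atTop 0] with u hu
    have := hψ.growth u 0 le_rfl hu
    rw [hb.diag 0 le_rfl] at this
    rw [zero_mul]
    linarith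

/-! ### The projection `Φ_h` -/

/-- The extension of `ψ` to `{(u, v) : v ≤ u, 0 ≤ u}` by `ψ (u, v) = ψ (u, 0) + h |v|` for `v < 0`.
The value `Φ_h(ψ)(u, v)` is the supremum of this extension over the diagonal translates of `(u, v)`
by `z ∈ [0, u]`. -/
def negExtension (h : ℝ) (ψ : ℝ → ℝ → ℝ) (u v : ℝ) : ℝ :=
  ψ u (max v 0) + h * max (-v) 0

theorem PhiProj_eq_sSup (h : ℝ) (ψ : ℝ → ℝ → ℝ) (u v : ℝ) :
    PhiProj h ψ u v = sSup ((fun z : ℝ => negExtension h ψ (u - z) (v - z)) '' Icc 0 u) := by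
  unfold PhiProj
  congr 1
  refine image_congr fun z _ => ?_
  unfold negExtension
  split_ifs with hz
  · rw [max_eq_left (sub_nonneg.2 hz), max_eq_right (by linarith), mul_zero, add_zero]
  · push Not at hz
    rw [max_eq_right (by linarith), max_eq_left (by linarith)]
    ring

theorem negExtension_of_nonneg {h : ℝ} {ψ : ℝ → ℝ → ℝ} {u v : ℝ} (hv : 0 ≤ v) :
    negExtension h ψ u v = ψ u v := by
  simp [negExtension, hv]

theorem negExtension_of_nonpos {h : ℝ} {ψ : ℝ → ℝ → ℝ} {u v : ℝ} (hv : v ≤ 0) :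
    negExtension h ψ u v = ψ u 0 + h * (-v) := by
  simp [negExtension, hv]

theorem PhiProj_le {h : ℝ} {ψ : ℝ → ℝ → ℝ} {u v c : ℝ} (hu : 0 ≤ u)
    (H : ∀ z ∈ Icc 0 u, negExtension h ψ (u - z) (v - z) ≤ c) : PhiProj h ψ u v ≤ c := by
  rw [PhiProj_eq_sSup]
  refine csSup_le ((nonempty_Icc.2 hu).image _) ?_
  rintro _ ⟨z, hz, rfl⟩
  exact H z hz

namespace IsBranching

variable {α h : ℝ} {ψ : ℝ → ℝ → ℝ}

theorem negExtension_le (hψ : IsBranching α ψ) (hα : h ≤ α) {u v : ℝ} (hu : 0 ≤ u)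
    (hvu : v ≤ u) : negExtension h ψ u v ≤ α * (u - v) := by
  rcases le_total 0 v with hv | hv
  · rw [negExtension_of_nonneg hv]
    exact hψ.le_mul_sub hv hvu
  · rw [negExtension_of_nonpos hv]
    have := hψ.le_mul_sub le_rfl hu
    nlinarith

theorem negExtension_lipschitz (hψ : IsBranching α ψ) (h0 : 0 ≤ h) (hα : h ≤ α) {u v u' v' : ℝ}
    (hu : 0 ≤ u) (hvu : v ≤ u) (hu' : 0 ≤ u') (hvu' : v' ≤ u') :
    negExtension h ψ u v ≤ negExtension h ψ u' v' + α * (|u - u'| + |v - v'|) := by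
  have h1 := (le_abs_self _).trans (hψ.lipschitz u (max v 0) u' (max v' 0) (le_max_right _ _)
    (max_le hvu hu) (le_max_right _ _) (max_le hvu' hu'))
  have h2 : |max v 0 - max v' 0| + (max (-v) 0 - max (-v') 0) ≤ |v - v'| := by
    rcases le_total 0 v with hv | hv <;> rcases le_total 0 v' with hv' | hv' <;>
      simp only [max_eq_left, max_eq_right, hv, hv', neg_nonpos.2, neg_nonneg.2] <;>
      grind
  have h3 : h * (max (-v) 0 - max (-v') 0) ≤ α * (|v - v'| - |max v 0 - max v' 0|) := by
    have h4 : |max v 0 - max v' 0| ≤ |v - v'| := by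
      rw [abs_sub_comm, abs_sub_comm v]
      exact (abs_max_sub_max_le_abs v' v 0)
    exact (mul_le_mul_of_nonneg_left (by linarith) h0).trans
      (mul_le_mul_of_nonneg_right hα (by linarith))
  unfold negExtension
  linarith

theorem bddAbove_negExtension (hψ : IsBranching α ψ) (hα : h ≤ α) {u v : ℝ}
    (hvu : v ≤ u) :
    BddAbove ((fun z : ℝ => negExtension h ψ (u - z) (v - z)) '' Icc 0 u) := by
  refine ⟨α * (u - v), ?_⟩
  rintro _ ⟨z, hz, rfl⟩
  have := hψ.negExtension_le hα (sub_nonneg.2 hz.2) (sub_le_sub_right hvu z)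
  rwa [sub_sub_sub_cancel_right] at this

theorem le_phiProj (hψ : IsBranching α ψ) (hα : h ≤ α) {u v z : ℝ}
    (hvu : v ≤ u) (hz : z ∈ Icc 0 u) :
    negExtension h ψ (u - z) (v - z) ≤ PhiProj h ψ u v := by
  rw [PhiProj_eq_sSup]
  exact le_csSup (hψ.bddAbove_negExtension hα hvu) (mem_image_of_mem _ hz)

theorem self_le_phiProj (hψ : IsBranching α ψ) (hα : h ≤ α) {u v : ℝ} (hv : 0 ≤ v)
    (hvu : v ≤ u) : ψ u v ≤ PhiProj h ψ u v := by
  have := hψ.le_phiProj hα hvu (left_mem_Icc.2 (hv.trans hvu))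
  rwa [sub_zero, sub_zero, negExtension_of_nonneg hv] at this

theorem mul_sub_le_phiProj (hψ : IsBranching α ψ) (hα : h ≤ α) {u v : ℝ} (hv : 0 ≤ v)
    (hvu : v ≤ u) : h * (u - v) ≤ PhiProj h ψ u v := by
  have := hψ.le_phiProj hα hvu (right_mem_Icc.2 (hv.trans hvu))
  rw [sub_self, negExtension_of_nonpos (by linarith), hψ.diag 0 le_rfl] at this
  linarith

/-- The range `[0, u]` of translates depends on `u`; a translate `z > u'` of `(u, v)` is compared
with the last translate `z = u'` of `(u', v')`, whose value is `h (u' - v')`. -/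
theorem phiProj_lipschitz (hψ : IsBranching α ψ) (h0 : 0 ≤ h) (hα : h ≤ α) {u v u' v' : ℝ}
    (hv : 0 ≤ v) (hvu : v ≤ u) (hv' : 0 ≤ v') (hvu' : v' ≤ u') :
    PhiProj h ψ u v ≤ PhiProj h ψ u' v' + α * (|u - u'| + |v - v'|) := by
  refine PhiProj_le (hv.trans hvu) fun z hz => ?_
  rcases le_total z u' with hzu | hzu
  · have h1 := hψ.negExtension_lipschitz h0 hα (sub_nonneg.2 hz.2) (sub_le_sub_right hvu z)
      (sub_nonneg.2 hzu) (sub_le_sub_right hvu' z)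
    have h2 := hψ.le_phiProj hα hvu' ⟨hz.1, hzu⟩
    rw [sub_sub_sub_cancel_right, sub_sub_sub_cancel_right] at h1
    linarith
  · have h1 := hψ.mul_sub_le_phiProj hα hv' hvu'
    have h2 := hz.2
    have hα0 := h0.trans hα
    have h3 : α * (u - u') ≤ α * |u - u'| := by gcongr; exact le_abs_self _
    have h4 : h * (v' - v) ≤ α * |v - v'| := by
      rw [abs_sub_comm]
      exact (mul_le_mul_of_nonneg_left (le_abs_self _) h0).trans (by gcongr)
    rcases le_total z v with hzv | hzv
    · rw [negExtension_of_nonneg (sub_nonneg.2 hzv)]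
      have h5 := hψ.le_mul_sub (sub_nonneg.2 hzv) (sub_le_sub_right hvu z)
      have h6 : α * (u - v) ≤ α * (u - u') := by gcongr; linarith
      have h7 : 0 ≤ h * (u' - v') := mul_nonneg h0 (by linarith)
      have h8 : 0 ≤ α * |v - v'| := by positivity
      linarith
    · rw [negExtension_of_nonpos (by linarith)]
      have h5 := hψ.le_mul_sub le_rfl (sub_nonneg.2 hz.2)
      have h6 : h * (z - u') ≤ α * (z - u') := by gcongr
      linarith

theorem isMonoBranching_phiProj (hψ : IsBranching α ψ) (h0 : 0 ≤ h) (hα : h ≤ α) :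
    IsMonoBranching h α (PhiProj h ψ) where
  nonneg u v hv hvu := (hψ.nonneg u v hv hvu).trans (hψ.self_le_phiProj hα hv hvu)
  diag u hu := by
    refine le_antisymm (PhiProj_le hu fun z hz => ?_) ?_
    · rw [negExtension_of_nonneg (sub_nonneg.2 hz.2), hψ.diag _ (sub_nonneg.2 hz.2)]
    · exact (hψ.diag u hu).symm.le.trans (hψ.self_le_phiProj hα hu le_rfl)
  subadd u w v hv hvw hwu := by
    refine PhiProj_le (hv.trans (hvw.trans hwu)) fun z hz => ?_
    have h1 := hψ.le_phiProj hα hwu hz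
    rcases le_total z w with hzw | hzw
    · have h2 := hψ.le_phiProj hα hvw ⟨hz.1, hzw⟩
      rw [negExtension_of_nonneg (sub_nonneg.2 hzw)] at h1
      have h3 := hψ.subadd (u - z) (w - z) (max (v - z) 0) (le_max_right _ _)
        (max_le (by linarith) (by linarith)) (by linarith)
      unfold negExtension at h2 ⊢
      linarith
    · have h2 := hψ.mul_sub_le_phiProj hα hv hvw
      rw [negExtension_of_nonpos (by linarith)] at h1 ⊢
      linarith
  mono_left u w v hv hvw hwu := by
    refine PhiProj_le (hv.trans hvw) fun z hz => ?_
    refine le_trans ?_ (hψ.le_phiProj hα (hvw.trans hwu) ⟨hz.1, hz.2.trans hwu⟩)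
    have := hψ.mono_left (u - z) (w - z) (max (v - z) 0) (le_max_right _ _)
      (max_le (by linarith) (by linarith [hz.2])) (by linarith)
    unfold negExtension
    linarith
  anti_right u w v hv hvw hwu := by
    refine PhiProj_le (hv.trans (hvw.trans hwu)) fun z hz => ?_
    refine le_trans ?_ (hψ.le_phiProj hα (hvw.trans hwu) hz)
    have h1 := hψ.anti_right (u - z) (max (w - z) 0) (max (v - z) 0) (le_max_right _ _)
      (max_le_max_right _ (by linarith)) (max_le (by linarith) (by linarith [hz.2]))
    have h2 : h * max (-(w - z)) 0 ≤ h * max (-(v - z)) 0 := by gcongr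
    unfold negExtension
    linarith
  lipschitz u v u' v' hv hvu hv' hvu' := by
    have h1 := hψ.phiProj_lipschitz h0 hα hv hvu hv' hvu'
    have h2 := hψ.phiProj_lipschitz h0 hα hv' hvu' hv hvu
    rw [abs_sub_comm u' u, abs_sub_comm v' v] at h2
    rw [abs_sub_le_iff]
    constructor <;> linarith
  diag_mono u v z hv hvu hz := by
    refine PhiProj_le (hv.trans hvu) fun y hy => ?_
    have := hψ.le_phiProj hα (add_le_add_left hvu z)
      (z := y + z) ⟨add_nonneg hy.1 hz, add_le_add_left hy.2 z⟩
    rwa [add_sub_add_right_eq_sub, add_sub_add_right_eq_sub] at this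
  growth u v hv hvu := by
    suffices PhiProj h ψ v 0 ≤ PhiProj h ψ u 0 - h * (u - v) by linarith
    refine PhiProj_le hv fun z hz => ?_
    have := hψ.le_phiProj hα (hv.trans hvu) (z := z + (u - v))
      ⟨by linarith [hz.1], by linarith [hz.2]⟩
    rw [negExtension_of_nonpos (by linarith [hz.1])] at this ⊢
    rw [show u - (z + (u - v)) = v - z by ring] at this
    linarith

end IsBranching

/-! ### The projection `Ω_h` -/

theorem IsLimitFun.le_mul_one_sub {α : ℝ} {γ : ℝ → ℝ} (hγ : IsLimitFun α γ) {θ : ℝ}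
    (hθ : θ ∈ Icc (0 : ℝ) 1) : γ θ ≤ α * (1 - θ) := by
  have h := hγ.lipschitz θ hθ 1 (right_mem_Icc.2 zero_le_one)
  rw [hγ.at_one, sub_zero, abs_sub_comm, abs_of_nonneg (sub_nonneg.2 hθ.2)] at h
  exact (le_abs_self _).trans h

theorem PsiQuot_of_lt (γ : ℝ → ℝ) {θ : ℝ} (hθ : θ < 1) : PsiQuot γ θ = γ θ / (1 - θ) :=
  if_pos hθ

theorem OmegaProj_one (h : ℝ) (γ : ℝ → ℝ) : OmegaProj h γ 1 = 0 := by
  simp [OmegaProj]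

theorem PsiQuot_OmegaProj (h : ℝ) (γ : ℝ → ℝ) {θ : ℝ} (hθ : θ < 1) :
    PsiQuot (OmegaProj h γ) θ = max h (sSup (PsiQuot γ '' Icc 0 θ)) := by
  rw [PsiQuot_of_lt _ hθ, OmegaProj, mul_div_cancel_left₀ _ (sub_pos.2 hθ).ne']

theorem mul_le_OmegaProj {h : ℝ} {γ : ℝ → ℝ} {θ : ℝ} (hθ : θ ≤ 1) :
    h * (1 - θ) ≤ OmegaProj h γ θ := by
  rw [OmegaProj, mul_comm]
  exact mul_le_mul_of_nonneg_left (le_max_left _ _) (sub_nonneg.2 hθ)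

theorem OmegaProj_le {h : ℝ} {γ : ℝ → ℝ} {θ c : ℝ} (hθ : θ ∈ Ico (0 : ℝ) 1) (hc : h ≤ c)
    (H : ∀ s ∈ Icc 0 θ, γ s / (1 - s) ≤ c) : OmegaProj h γ θ ≤ (1 - θ) * c := by
  refine mul_le_mul_of_nonneg_left (max_le hc ?_) (sub_pos.2 hθ.2).le
  refine csSup_le ((nonempty_Icc.2 hθ.1).image _) ?_
  rintro _ ⟨s, hs, rfl⟩
  rw [PsiQuot_of_lt γ (hs.2.trans_lt hθ.2)]
  exact H s hs

namespace IsLimitFun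

variable {α h : ℝ} {γ : ℝ → ℝ}

theorem psiQuot_le (hγ : IsLimitFun α γ) {θ : ℝ} (hθ : θ ∈ Ico (0 : ℝ) 1) : PsiQuot γ θ ≤ α := by
  rw [PsiQuot_of_lt _ hθ.2, div_le_iff₀ (sub_pos.2 hθ.2)]
  exact hγ.le_mul_one_sub ⟨hθ.1, hθ.2.le⟩

theorem bddAbove_psiQuot (hγ : IsLimitFun α γ) {θ : ℝ} (hθ : θ < 1) :
    BddAbove (PsiQuot γ '' Icc 0 θ) := by
  refine ⟨α, ?_⟩
  rintro _ ⟨s, hs, rfl⟩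
  exact hγ.psiQuot_le ⟨hs.1, hs.2.trans_lt hθ⟩

theorem psiQuot_le_sSup (hγ : IsLimitFun α γ) {s θ : ℝ} (hs : s ∈ Icc 0 θ) (hθ : θ < 1) :
    PsiQuot γ s ≤ sSup (PsiQuot γ '' Icc 0 θ) :=
  le_csSup (hγ.bddAbove_psiQuot hθ) (mem_image_of_mem _ hs)

theorem mul_div_le_omegaProj (hγ : IsLimitFun α γ) {s θ : ℝ} (hs : s ∈ Icc 0 θ) (hθ : θ < 1) :
    (1 - θ) * (γ s / (1 - s)) ≤ OmegaProj h γ θ := by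
  rw [OmegaProj, ← PsiQuot_of_lt γ (hs.2.trans_lt hθ)]
  exact mul_le_mul_of_nonneg_left ((hγ.psiQuot_le_sSup hs hθ).trans (le_max_right _ _))
    (sub_pos.2 hθ).le

theorem le_omegaProj (hγ : IsLimitFun α γ) {θ : ℝ} (hθ : θ ∈ Icc (0 : ℝ) 1) :
    γ θ ≤ OmegaProj h γ θ := by
  rcases hθ.2.eq_or_lt with rfl | h1
  · rw [OmegaProj_one, hγ.at_one]
  · have := hγ.mul_div_le_omegaProj (h := h) (right_mem_Icc.2 hθ.1) h1
    rwa [mul_div_cancel₀ _ (sub_pos.2 h1).ne'] at this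

/-- Subadditivity of `Ω_h(γ)` follows from monotonicity of the quotient by `1 - θ`, because
`1 - λ θ = (1 - θ) + θ (1 - λ)`. -/
theorem isMonoLimitFun_omegaProj (hγ : IsLimitFun α γ) (h0 : 0 ≤ h) (hα : h ≤ α) :
    IsMonoLimitFun h α (OmegaProj h γ) := by
  have mono : MonotoneOn (fun θ => OmegaProj h γ θ / (1 - θ)) (Ico 0 1) := by
    intro s hs t ht hst
    simp only [← PsiQuot_of_lt _ hs.2, ← PsiQuot_of_lt _ ht.2, PsiQuot_OmegaProj _ _ hs.2,
      PsiQuot_OmegaProj _ _ ht.2]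
    exact max_le_max le_rfl (csSup_le_csSup (hγ.bddAbove_psiQuot ht.2)
      ((nonempty_Icc.2 hs.1).image _) (image_mono (Icc_subset_Icc_right hst)))
  have nonneg : ∀ θ ∈ Icc (0 : ℝ) 1, 0 ≤ OmegaProj h γ θ := fun θ hθ =>
    (mul_nonneg h0 (sub_nonneg.2 hθ.2)).trans (mul_le_OmegaProj hθ.2)
  have upper : ∀ θ ∈ Ico (0 : ℝ) 1, OmegaProj h γ θ / (1 - θ) ≤ α := fun θ hθ => by
    rw [div_le_iff₀ (sub_pos.2 hθ.2), mul_comm]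
    refine OmegaProj_le hθ hα fun s hs => ?_
    rw [← PsiQuot_of_lt γ (hs.2.trans_lt hθ.2)]
    exact hγ.psiQuot_le ⟨hs.1, hs.2.trans_lt hθ.2⟩
  have eq : ∀ θ ∈ Ico (0 : ℝ) 1,
      OmegaProj h γ θ = (1 - θ) * (OmegaProj h γ θ / (1 - θ)) := fun θ hθ =>
    (mul_div_cancel₀ _ (sub_pos.2 hθ.2).ne').symm
  have anti : AntitoneOn (OmegaProj h γ) (Icc 0 1) := by
    intro s hs t ht hst
    rcases ht.2.eq_or_lt with rfl | ht1
    · rw [OmegaProj_one]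
      exact nonneg s hs
    have ht1' : 0 < 1 - t := sub_pos.2 ht1
    have hs1 := hst.trans_lt ht1
    suffices OmegaProj h γ t ≤ (1 - t) * (OmegaProj h γ s / (1 - t)) by
      rwa [mul_div_cancel₀ _ ht1'.ne'] at this
    refine OmegaProj_le ⟨ht.1, ht1⟩ ?_ fun l hl => ?_
    · rw [le_div_iff₀ ht1']
      exact (mul_le_mul_of_nonneg_left (by linarith) h0).trans (mul_le_OmegaProj hs.2)
    · rw [le_div_iff₀ ht1']
      have hl1 : 0 < 1 - l := by linarith [hl.2]
      have hγl := hγ.nonneg l ⟨hl.1, by linarith⟩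
      rcases le_total l s with hls | hls
      · have h1 := hγ.mul_div_le_omegaProj (h := h) ⟨hl.1, hls⟩ hs1
        have h2 : 0 ≤ γ l / (1 - l) := div_nonneg hγl hl1.le
        nlinarith
      · have h1 := hγ.anti hs ⟨hl.1, by linarith⟩ hls
        have h2 := hγ.le_omegaProj (h := h) hs
        rw [div_mul_eq_mul_div, div_le_iff₀ hl1]
        have h3 := nonneg s hs
        have h4 : γ l * (1 - t) ≤ γ l * (1 - l) :=
          mul_le_mul_of_nonneg_left (by linarith [hl.2]) hγl
        have h5 : γ l * (1 - l) ≤ OmegaProj h γ s * (1 - l) :=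
          mul_le_mul_of_nonneg_right (h1.trans h2) hl1.le
        linarith
  have lip : ∀ s ∈ Icc (0 : ℝ) 1, ∀ t ∈ Icc (0 : ℝ) 1, s ≤ t →
      OmegaProj h γ s - OmegaProj h γ t ≤ α * (t - s) := by
    intro s hs t ht hst
    rcases hs.2.eq_or_lt with rfl | hs1
    · rw [le_antisymm ht.2 hst]
      simp
    have h1 := upper s ⟨hs.1, hs1⟩
    rcases ht.2.eq_or_lt with rfl | ht1
    · rw [OmegaProj_one, sub_zero, ← div_le_iff₀ (sub_pos.2 hs1)]
      exact h1
    · have h2 := mono ⟨hs.1, hs1⟩ ⟨ht.1, ht1⟩ hst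
      rw [eq s ⟨hs.1, hs1⟩, eq t ⟨ht.1, ht1⟩]
      simp only at h2
      nlinarith
  refine ⟨⟨nonneg, OmegaProj_one h γ, anti, fun l hl θ hθ => ?_, fun s hs t ht => ?_⟩, mono, ?_⟩
  · rcases hl.2.eq_or_lt with rfl | hl1
    · rw [one_mul, OmegaProj_one, mul_zero, add_zero]
    rcases hθ.2.eq_or_lt with rfl | hθ1
    · rw [mul_one, OmegaProj_one, one_mul, zero_add]
    have hm : l * θ ∈ Ico (0 : ℝ) 1 := ⟨mul_nonneg hl.1 hθ.1, by nlinarith [hθ.1, hl.1]⟩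
    have h1 := mono hm ⟨hl.1, hl1⟩ (by nlinarith [hθ.1, hl.1])
    have h2 := mono hm ⟨hθ.1, hθ1⟩ (by nlinarith [hθ.1, hl.1])
    simp only at h1 h2
    rw [eq _ hm, eq l ⟨hl.1, hl1⟩, eq θ ⟨hθ.1, hθ1⟩]
    have h3 := mul_le_mul_of_nonneg_left h1 (mul_nonneg hθ.1 (sub_pos.2 hl1).le)
    have h4 := mul_le_mul_of_nonneg_left h2 (sub_pos.2 hθ1).le
    linarith
  · rcases le_total s t with hst | hst
    · rw [abs_of_nonneg (sub_nonneg.2 (anti hs ht hst)), abs_sub_comm,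
        abs_of_nonneg (sub_nonneg.2 hst)]
      exact lip s hs t ht hst
    · rw [abs_sub_comm, abs_of_nonneg (sub_nonneg.2 (anti ht hs hst)),
        abs_of_nonneg (sub_nonneg.2 hst)]
      exact lip t ht s hs hst
  · have := mul_le_OmegaProj (h := h) (γ := γ) zero_le_one
    rwa [sub_zero, mul_one] at this

end IsLimitFun

namespace IsMonoLimitFun

variable {α h : ℝ} {γ ξ : ℝ → ℝ}

theorem omegaProj_le (hξ : IsMonoLimitFun h α ξ) (H : ∀ θ ∈ Icc (0 : ℝ) 1, γ θ ≤ ξ θ) {θ : ℝ}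
    (hθ : θ ∈ Icc (0 : ℝ) 1) : OmegaProj h γ θ ≤ ξ θ := by
  rcases hθ.2.eq_or_lt with rfl | h1
  · rw [OmegaProj_one, hξ.at_one]
  have h1' := sub_pos.2 h1
  have := OmegaProj_le (γ := γ) (h := h) (c := ξ θ / (1 - θ)) ⟨hθ.1, h1⟩ ?_ fun s hs => ?_
  · rwa [mul_div_cancel₀ _ h1'.ne'] at this
  · have := hξ.mono (left_mem_Ico.2 zero_lt_one) ⟨hθ.1, h1⟩ hθ.1
    simp only [sub_zero, div_one] at this
    exact hξ.le_at_zero.trans this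
  · have hs1 := hs.2.trans_lt h1
    refine le_trans ?_ (hξ.mono ⟨hs.1, hs1⟩ ⟨hθ.1, h1⟩ hs.2)
    exact div_le_div_of_nonneg_right (H s ⟨hs.1, hs1.le⟩) (sub_pos.2 hs1).le

theorem omegaProj_eqOn (hξ : IsMonoLimitFun h α ξ) : EqOn (OmegaProj h ξ) ξ (Icc 0 1) :=
  fun _ hθ => le_antisymm (hξ.omegaProj_le (fun _ _ => le_rfl) hθ)
    (hξ.toIsLimitFun.le_omegaProj hθ)

/-- The function `(u, v) ↦ u ξ(v / u)`, which is homogeneous of degree one, lies in `𝓑̄_h(α)` when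
`ξ` lies in `𝓖̄_h(α)`. -/
theorem isMonoBranching_homogeneous (hξ : IsMonoLimitFun h α ξ) :
    IsMonoBranching h α (fun u v => u * ξ (v / u)) := by
  have mem : ∀ {u v : ℝ}, 0 ≤ v → v ≤ u → v / u ∈ Icc (0 : ℝ) 1 := fun hv hvu =>
    ⟨div_nonneg hv (hv.trans hvu), div_le_one_of_le₀ hvu (hv.trans hvu)⟩
  have anti : ∀ {u w v : ℝ}, 0 ≤ v → v ≤ w → w ≤ u → u * ξ (w / u) ≤ u * ξ (v / u) :=
    fun {u w v} hv hvw hwu => by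
    have hu := hv.trans (hvw.trans hwu)
    exact mul_le_mul_of_nonneg_left (hξ.anti (mem hv (hvw.trans hwu)) (mem (hv.trans hvw) hwu)
      (by gcongr)) hu
  have mono : ∀ {u w v : ℝ}, 0 ≤ v → v ≤ w → w ≤ u → w * ξ (v / w) ≤ u * ξ (v / u) :=
    fun {u w v} hv hvw hwu => by
    rcases (hv.trans hvw).eq_or_lt with rfl | hw
    · rw [zero_mul]
      exact mul_nonneg hwu (hξ.nonneg _ (mem hv (hvw.trans hwu)))
    · have h1 := hξ.anti (mem hv (hvw.trans hwu)) (mem hv hvw)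
        (div_le_div_of_nonneg_left hv hw hwu)
      exact mul_le_mul hwu h1 (hξ.nonneg _ (mem hv hvw)) (hw.le.trans hwu)
  have lip_right : ∀ {u w v : ℝ}, 0 ≤ v → v ≤ w → w ≤ u →
      u * ξ (v / u) - u * ξ (w / u) ≤ α * (w - v) := fun {u w v} hv hvw hwu => by
    rcases (hv.trans (hvw.trans hwu)).eq_or_lt with rfl | hu
    · rw [le_antisymm (hvw.trans hwu) hv, le_antisymm hwu (hv.trans hvw)]
      simp
    have h1 := (le_abs_self _).trans (hξ.lipschitz _ (mem hv (hvw.trans hwu)) _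
      (mem (hv.trans hvw) hwu))
    rw [← sub_div, abs_div, abs_of_pos hu, abs_sub_comm, abs_of_nonneg (sub_nonneg.2 hvw),
      ← mul_div_assoc, le_div_iff₀ hu] at h1
    linarith
  -- In the increment `(u - w) ξ(v / u) + w (ξ(v / u) - ξ(v / w))` the decay `ξ(θ) ≤ α (1 - θ)` of
  -- the first term and the Lipschitz bound for the second one add up to exactly `α (u - w)`.
  have lip_left : ∀ {u w v : ℝ}, 0 ≤ v → v ≤ w → w ≤ u →
      u * ξ (v / u) - w * ξ (v / w) ≤ α * (u - w) := fun {u w v} hv hvw hwu => by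
    rcases (hv.trans hvw).eq_or_lt with rfl | hw
    · rw [le_antisymm hvw hv, zero_mul, sub_zero, sub_zero, zero_div, mul_comm]
      have h1 := hξ.toIsLimitFun.le_mul_one_sub (left_mem_Icc.2 zero_le_one)
      rw [sub_zero, mul_one] at h1
      exact mul_le_mul_of_nonneg_right h1 hwu
    have hu := hw.trans_le hwu
    have h1 := hξ.toIsLimitFun.le_mul_one_sub (mem hv (hvw.trans hwu))
    have h2 := (le_abs_self _).trans (hξ.lipschitz _ (mem hv (hvw.trans hwu)) _ (mem hv hvw))
    have h3 : v / u ≤ v / w := div_le_div_of_nonneg_left hv hw hwu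
    rw [abs_sub_comm, abs_of_nonneg (sub_nonneg.2 h3)] at h2
    have h4 := mul_le_mul_of_nonneg_left h1 (sub_nonneg.2 hwu)
    have h5 := mul_le_mul_of_nonneg_left h2 hw.le
    have e1 : w * (v / w) = v := mul_div_cancel₀ _ hw.ne'
    have e2 : u * (v / u) = v := mul_div_cancel₀ _ hu.ne'
    have e3 : w * (α * (v / w - v / u)) + (u - w) * (α * (1 - v / u)) = α * (u - w) := by
      linear_combination α * e1 - α * e2
    linarith
  have lip : ∀ {u v u' v' : ℝ}, 0 ≤ v → v ≤ u → 0 ≤ v' → v' ≤ u' → u' ≤ u →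
      |u * ξ (v / u) - u' * ξ (v' / u')| ≤ α * (|u - u'| + |v - v'|) :=
    fun {u v u' v'} hv hvu hv' hvu' huu => by
    have h1 : |u * ξ (v' / u) - u' * ξ (v' / u')| ≤ α * |u - u'| := by
      rw [abs_of_nonneg (sub_nonneg.2 (mono hv' hvu' huu)), abs_of_nonneg (sub_nonneg.2 huu)]
      exact lip_left hv' hvu' huu
    have h2 : |u * ξ (v / u) - u * ξ (v' / u)| ≤ α * |v - v'| := by
      rcases le_total v v' with hvv | hvv
      · rw [abs_of_nonneg (sub_nonneg.2 (anti hv hvv (hvu'.trans huu))), abs_sub_comm v,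
          abs_of_nonneg (sub_nonneg.2 hvv)]
        exact lip_right hv hvv (hvu'.trans huu)
      · rw [abs_sub_comm, abs_of_nonneg (sub_nonneg.2 (anti hv' hvv hvu)),
          abs_of_nonneg (sub_nonneg.2 hvv)]
        exact lip_right hv' hvv hvu
    have h3 := abs_sub_le (u * ξ (v / u)) (u * ξ (v' / u)) (u' * ξ (v' / u'))
    linarith
  refine ⟨⟨fun u v hv hvu => mul_nonneg (hv.trans hvu) (hξ.nonneg _ (mem hv hvu)), fun u hu => ?_,
    fun u w v hv hvw hwu => ?_, fun u w v => mono, fun u w v => anti,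
    fun u v u' v' hv hvu hv' hvu' => ?_⟩, fun u v z hv hvu hz => ?_, fun u v hv hvu => ?_⟩
  · rcases hu.eq_or_lt with rfl | hu
    · simp
    · simp [div_self hu.ne', hξ.at_one]
  · rcases (hv.trans hvw).eq_or_lt with rfl | hw
    · simp [le_antisymm hvw hv]
    have hu := hw.trans_le hwu
    have h1 := hξ.subadd _ (mem hv hvw) _ (mem hw.le hwu)
    rw [div_mul_div_cancel₀ hw.ne'] at h1
    have h2 := mul_le_mul_of_nonneg_left h1 hu.le
    rwa [mul_add, ← mul_assoc, mul_div_cancel₀ _ hu.ne'] at h2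
  · rcases le_total u' u with h | h
    · exact lip hv hvu hv' hvu' h
    · rw [abs_sub_comm, abs_sub_comm u, abs_sub_comm v]
      exact lip hv' hvu' hv hvu h
  · rcases hvu.eq_or_lt with rfl | hlt
    · rcases hv.eq_or_lt with rfl | hv
      · rw [zero_mul]
        exact mul_nonneg (by linarith) (hξ.nonneg _ (mem (by linarith) le_rfl))
      · simp only [div_self hv.ne', hξ.at_one, mul_zero]
        exact mul_nonneg (by linarith) (hξ.nonneg _ (mem (by linarith) le_rfl))
    have hu : 0 < u := hv.trans_lt hlt
    have huz : 0 < u + z := by linarith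
    have h1 := hξ.mono (a := v / u) (b := (v + z) / (u + z))
      ⟨div_nonneg hv hu.le, (div_lt_one hu).2 hlt⟩
      ⟨div_nonneg (by linarith) huz.le, (div_lt_one huz).2 (by linarith)⟩
      (by rw [div_le_div_iff₀ hu huz]; nlinarith)
    simp only [one_sub_div hu.ne', one_sub_div huz.ne', add_sub_add_right_eq_sub] at h1
    rw [div_div_eq_mul_div, div_div_eq_mul_div, div_le_div_iff_of_pos_right (sub_pos.2 hlt)] at h1
    linarith
  · simp only [zero_div]
    have := hξ.le_at_zero
    rw [← sub_mul, mul_comm]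
    exact mul_le_mul_of_nonneg_left this (sub_nonneg.2 hvu)

end IsMonoLimitFun

theorem gammaLim_homogeneous (ξ : ℝ → ℝ) (θ : ℝ) :
    GammaLim (fun u v => u * ξ (v / u)) θ = ξ θ := by
  refine Tendsto.limsup_eq (tendsto_const_nhds.congr' ?_)
  filter_upwards [eventually_gt_atTop 0] with u hu
  rw [mul_div_cancel_right₀ _ hu.ne', mul_div_cancel_left₀ _ hu.ne']

/-! ### Uniformity in the angle and the commuting diagram -/

namespace IsBranching

variable {α h : ℝ} {ψ : ℝ → ℝ → ℝ}

/-- The upper bound in the upper limit `Γ(ψ)(θ)` holds uniformly in `θ`, by compactness of `[0, 1]`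
and the Lipschitz condition. -/
theorem eventually_forall_le_gammaLim (hψ : IsBranching α ψ) {ε : ℝ} (hε : 0 < ε) :
    ∀ᶠ u in atTop, ∀ θ ∈ Icc (0 : ℝ) 1, ψ u (θ * u) ≤ (GammaLim ψ θ + ε) * u := by
  refine isCompact_Icc.induction_on
    (p := fun S => ∀ᶠ u in atTop, ∀ θ ∈ S ∩ Icc (0 : ℝ) 1, ψ u (θ * u) ≤ (GammaLim ψ θ + ε) * u)
    (by simp) (fun s t hst ht => ht.mono fun u hu θ hθ => hu θ ⟨hst hθ.1, hθ.2⟩)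
    (fun s t hs ht => ?_) (fun s hs => ?_) |>.mono fun u hu θ hθ => hu θ ⟨hθ, hθ⟩
  · filter_upwards [hs, ht] with u h1 h2 θ hθ
    exact hθ.1.elim (fun h => h1 θ ⟨h, hθ.2⟩) (fun h => h2 θ ⟨h, hθ.2⟩)
  · have hα : 0 < |α| + 1 := by positivity
    set δ := ε / (4 * (|α| + 1)) with hδ
    have hδ0 : 0 < δ := by positivity
    refine ⟨_, mem_nhdsWithin_of_mem_nhds (Metric.ball_mem_nhds s hδ0), ?_⟩
    filter_upwards [hψ.eventually_le_gammaLim hs (half_pos hε), eventually_ge_atTop 0]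
      with u hu hu0 θ hθ
    have hd : |θ - s| < δ := hθ.1
    have hαδ : α * |θ - s| ≤ ε / 4 := by
      have h1 : (|α| + 1) * δ = ε / 4 := by
        rw [hδ]
        field_simp
      have h2 : α ≤ |α| + 1 := (le_abs_self α).trans (by linarith)
      calc α * |θ - s| ≤ (|α| + 1) * δ := mul_le_mul h2 hd.le (abs_nonneg _) hα.le
        _ = ε / 4 := h1
    have h1 := (le_abs_self _).trans (hψ.isLimitFun_gammaLim.lipschitz s hs θ hθ.2)
    rw [abs_sub_comm] at h1
    have hθu := mul_mem_of_angle hθ.2 hu0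
    have hsu := mul_mem_of_angle hs hu0
    have h2 := (le_abs_self _).trans
      (hψ.lipschitz u (θ * u) u (s * u) hθu.1 hθu.2 hsu.1 hsu.2)
    rw [sub_self, abs_zero, zero_add, ← sub_mul, abs_mul, abs_of_nonneg hu0] at h2
    have h3 : α * |θ - s| * u ≤ ε / 4 * u := by gcongr
    have h4 : GammaLim ψ s * u ≤ (GammaLim ψ θ + ε / 4) * u := by gcongr; linarith
    linarith

/-- The commuting diagram `Γ ∘ Φ_h = Ω_h ∘ Γ`. -/
theorem gammaLim_phiProj_eqOn (hψ : IsBranching α ψ) (h0 : 0 ≤ h) (hα : h ≤ α) :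
    EqOn (GammaLim (PhiProj h ψ)) (OmegaProj h (GammaLim ψ)) (Icc 0 1) := by
  have hΦ := hψ.isMonoBranching_phiProj h0 hα
  have hγ := hψ.isLimitFun_gammaLim
  intro θ hθ
  refine le_antisymm ?_ (hΦ.isMonoLimitFun_gammaLim.omegaProj_le (fun t ht =>
    hψ.gammaLim_le_gammaLim hΦ.toIsBranching ht fun u hu =>
      hψ.self_le_phiProj hα (mul_mem_of_angle ht hu).1 (mul_mem_of_angle ht hu).2) hθ)
  rcases hθ.2.eq_or_lt with rfl | hθ1
  · rw [OmegaProj_one, hΦ.isMonoLimitFun_gammaLim.at_one]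
  refine hΦ.toIsBranching.gammaLim_le hθ fun ε hε => ?_
  set M := max h (sSup (PsiQuot (GammaLim ψ) '' Icc 0 θ)) with hM
  have hM1 : OmegaProj h (GammaLim ψ) θ = (1 - θ) * M := rfl
  have hhM : h ≤ M := le_max_left _ _
  have hγM : ∀ s ∈ Icc 0 θ, GammaLim ψ s ≤ M * (1 - s) := fun s hs => by
    have hs1 := hs.2.trans_lt hθ1
    rw [← div_le_iff₀ (sub_pos.2 hs1), ← PsiQuot_of_lt _ hs1]
    exact (hγ.psiQuot_le_sSup hs hθ1).trans (le_max_right _ _)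
  obtain ⟨U, hU⟩ := eventually_atTop.1 (hψ.eventually_forall_le_gammaLim (half_pos hε))
  set V := max U 0 with hV
  -- Below `V` the crude bound `ψ (w, 0) ≤ α V` replaces the asymptotic one.
  have hzero : ∀ w, 0 ≤ w → ψ w 0 ≤ (M + ε / 2) * w + α * V := fun w hw => by
    have hM0 : 0 ≤ M := h0.trans hhM
    have hα0 := h0.trans hα
    rcases le_total V w with h1 | h1
    · have h2 := hU w ((le_max_left _ _).trans h1) 0 (left_mem_Icc.2 zero_le_one)
      rw [zero_mul] at h2
      have h3 := hγM 0 (left_mem_Icc.2 hθ.1)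
      rw [sub_zero, mul_one] at h3
      have h4 : (GammaLim ψ 0 + ε / 2) * w ≤ (M + ε / 2) * w := by gcongr
      have h5 : 0 ≤ α * V := mul_nonneg hα0 (le_max_right _ _)
      linarith
    · have h2 := hψ.le_mul_sub le_rfl hw
      have h3 : α * (w - 0) ≤ α * V := by rw [sub_zero]; gcongr
      have h4 : 0 ≤ (M + ε / 2) * w := by positivity
      linarith
  have hθ1' := sub_pos.2 hθ1
  filter_upwards [eventually_ge_atTop (2 * (α * V) / ε), eventually_ge_atTop (V / (1 - θ)),
    eventually_ge_atTop 0] with u hu1 hu2 hu0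
  rw [div_le_iff₀ hε] at hu1
  rw [div_le_iff₀ hθ1'] at hu2
  have hθu := mul_mem_of_angle hθ hu0
  rw [hM1]
  refine PhiProj_le hu0 fun z hz => ?_
  rcases le_total z (θ * u) with hzθ | hzθ
  · rw [negExtension_of_nonneg (sub_nonneg.2 hzθ)]
    set w := u - z with hw
    have hwV : V ≤ w := by linarith
    rcases ((le_max_right U 0).trans hwV).eq_or_lt with hw0 | hw0
    · have h1 : θ * u - z = w := by linarith [mul_nonneg hθ1'.le hu0]
      rw [h1, hψ.diag w hw0.le]
      have := h0.trans hhM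
      positivity
    set s := (θ * u - z) / w with hs
    have hsw : s * w = θ * u - z := div_mul_cancel₀ _ hw0.ne'
    have hs0 : 0 ≤ s := div_nonneg (sub_nonneg.2 hzθ) hw0.le
    have hsθ : s ≤ θ := by
      rw [hs, div_le_iff₀ hw0]
      nlinarith [hz.1]
    have h1 := hU w ((le_max_left _ _).trans hwV) s ⟨hs0, hsθ.trans hθ.2⟩
    rw [hsw] at h1
    have h2 := mul_le_mul_of_nonneg_right (hγM s ⟨hs0, hsθ⟩) hw0.le
    have h3 : M * (1 - s) * w = M * (u - θ * u) := by linear_combination (-M) * hsw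
    have h4 : ε / 2 * w ≤ ε * u := by nlinarith [hz.1, hz.2]
    linarith
  · rw [negExtension_of_nonpos (by linarith)]
    have h1 := hzero (u - z) (sub_nonneg.2 hz.2)
    have h2 := mul_le_mul_of_nonneg_right hhM (sub_nonneg.2 hzθ)
    have h3 : ε / 2 * (u - z) ≤ ε / 2 * u := by gcongr; linarith [hz.1]
    linarith

end IsBranching

/-! ### Sublinear error terms -/

/-- A monotone function with `L(u) / u → h` satisfies the upper bound on the whole half-line, at the
price of an additive constant. -/
theorem MonotoneOn.exists_le_of_tendsto_div {L : ℝ → ℝ} {h ε : ℝ} (hL : MonotoneOn L (Ici 0))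
    (hlim : Tendsto (fun u => L u / u) atTop (𝓝 h)) (h0 : 0 ≤ h) (hε : 0 < ε) :
    ∃ K, 0 ≤ K ∧ ∀ u, 0 ≤ u → L u ≤ (h + ε) * u + K := by
  obtain ⟨U, hU⟩ := eventually_atTop.1 (hlim.eventually (gt_mem_nhds (lt_add_of_pos_right h hε)))
  refine ⟨max (L (max U 1)) 0, le_max_right _ _, fun u hu => ?_⟩
  rcases le_total (max U 1) u with h1 | h1
  · have hu0 : 0 < u := lt_of_lt_of_le one_pos ((le_max_right _ _).trans h1)
    have := (div_lt_iff₀ hu0).1 (hU u ((le_max_left _ _).trans h1))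
    linarith [le_max_right (L (max U 1)) 0]
  · have h2 := hL hu (mem_Ici.2 (hu.trans h1)) h1
    have h3 : 0 ≤ (h + ε) * u := by positivity
    linarith [le_max_left (L (max U 1)) 0]

theorem exists_ge_of_tendsto_div {L : ℝ → ℝ} {h ε : ℝ} (hL : ∀ u, 0 ≤ u → 0 ≤ L u)
    (hlim : Tendsto (fun u => L u / u) atTop (𝓝 h)) (h0 : 0 ≤ h) (hε : 0 < ε) :
    ∃ K, 0 ≤ K ∧ ∀ u, 0 ≤ u → (h - ε) * u - K ≤ L u := by
  obtain ⟨U, hU⟩ := eventually_atTop.1 (hlim.eventually (lt_mem_nhds (sub_lt_self h hε)))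
  refine ⟨h * max U 1, by positivity, fun u hu => ?_⟩
  rcases le_total (max U 1) u with h1 | h1
  · have hu0 : 0 < u := lt_of_lt_of_le one_pos ((le_max_right _ _).trans h1)
    have := (lt_div_iff₀ hu0).1 (hU u ((le_max_left _ _).trans h1))
    have h2 : 0 ≤ h * max U 1 := by positivity
    linarith
  · have h2 : h * u ≤ h * max U 1 := by gcongr
    have h3 : 0 ≤ ε * u := by positivity
    linarith [hL u hu]

theorem IsErrorFun.exists_le {η : ℝ → ℝ} (hη : IsErrorFun η) {ε : ℝ} (hε : 0 < ε) :
    ∃ K, 0 ≤ K ∧ ∀ u, 0 ≤ u → η u ≤ ε * u + K := by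
  simpa using hη.mono.exists_le_of_tendsto_div hη.tendsto le_rfl hε

/-! ### Weights on finite words -/

/-- A weight on finite words that is superadditive, subadditive up to the constant `A`, at least `a`
on letters, and at most `b - A` on letters; appending a letter increases it by an amount in
`[a, b]`. -/
structure WordWeight {ι : Type*} (ρ : List ι → ℝ) (a b A : ℝ) : Prop where
  nil : ρ [] = 0
  a_pos : 0 < a
  b_nonneg : 0 ≤ b
  superadd : ∀ w w', ρ w + ρ w' ≤ ρ (w ++ w')
  subadd : ∀ w w', ρ (w ++ w') ≤ ρ w + ρ w' + A
  le_letter : ∀ i, a ≤ ρ [i]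
  letter_le : ∀ i, ρ [i] + A ≤ b

/-- The words cut off at weight `t`: the shortest prefixes of infinite words with weight at least
`t`. For `t > 0` this is `wordsAt ρ t`, and for `t ≤ 0` only the empty word is left. -/
def cutWords {ι : Type*} (ρ : List ι → ℝ) (t : ℝ) : Set (List ι) :=
  {w | t ≤ ρ w ∧ (w ≠ [] → ρ w.dropLast < t)}

theorem Set.Finite.ncard_image2_le {β γ δ : Type*} (f : β → γ → δ) {s : Set β} {t : Set γ}
    (hs : s.Finite) (ht : t.Finite) : (image2 f s t).ncard ≤ s.ncard * t.ncard := by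
  rw [← image_uncurry_prod, ← ncard_prod]
  exact ncard_image_le (hs.prod ht)

theorem MinimallyDistorting.exists_wordWeight {X ι : Type*} [MetricSpace X] [Finite ι] [Nonempty ι]
    {f : ι → X → X} {F : Set X} {ρ : List ι → ℝ} (hf : MinimallyDistorting f F ρ) :
    ∃ a b A, WordWeight ρ a b A := by
  obtain ⟨A, hA, hadd⟩ := hf.almost_additive
  obtain ⟨i, hi⟩ := Finite.exists_min (fun i => ρ [i])
  obtain ⟨j, hj⟩ := Finite.exists_max (fun i => ρ [i])
  refine ⟨ρ [i], ρ [j] + A, A, hf.nil, hf.pos _ (by simp), add_nonneg (hf.pos _ (by simp)).le hA,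
    fun w w' => ?_, fun w w' => ?_, hi, fun k => add_le_add_left (hj k) A⟩
  · linarith [(hadd w w').1]
  · linarith [(hadd w w').2]

theorem exists_prefix_mem_cutWords {ι : Type*} {ρ : List ι → ℝ} {t : ℝ} {w : List ι}
    (hw : t ≤ ρ w) : ∃ p ∈ cutWords ρ t, ∃ q, w = p ++ q := by
  induction w using List.reverseRecOn with
  | nil => exact ⟨[], ⟨hw, fun h => absurd rfl h⟩, [], rfl⟩
  | append_singleton w i ih =>
    rcases le_or_gt t (ρ w) with h | h
    · obtain ⟨p, hp, q, rfl⟩ := ih h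
      exact ⟨p, hp, q ++ [i], List.append_assoc _ _ _⟩
    · exact ⟨w ++ [i], ⟨hw, fun _ => by simpa using h⟩, [], by simp⟩

namespace WordWeight

variable {ι : Type*} {ρ : List ι → ℝ} {a b A : ℝ}

theorem mul_length_le (hρ : WordWeight ρ a b A) (w : List ι) : a * w.length ≤ ρ w := by
  induction w with
  | nil => simp [hρ.nil]
  | cons i w ih =>
    have h1 := hρ.superadd [i] w
    have h2 := hρ.le_letter i
    simp only [List.singleton_append] at h1
    push_cast [List.length_cons]
    linarith

theorem nonneg (hρ : WordWeight ρ a b A) (w : List ι) : 0 ≤ ρ w :=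
  (mul_nonneg hρ.a_pos.le (Nat.cast_nonneg _)).trans (hρ.mul_length_le w)

theorem le_append (hρ : WordWeight ρ a b A) (w w' : List ι) : ρ w ≤ ρ (w ++ w') := by
  linarith [hρ.superadd w w', hρ.nonneg w']

theorem append_letter_le (hρ : WordWeight ρ a b A) (w : List ι) (i : ι) :
    ρ (w ++ [i]) ≤ ρ w + b := by
  linarith [hρ.subadd w [i], hρ.letter_le i]

theorem finite_le [Finite ι] (hρ : WordWeight ρ a b A) (c : ℝ) : {w | ρ w ≤ c}.Finite := by
  refine (List.finite_length_le ι ⌊c / a⌋₊).subset fun w hw => ?_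
  refine Nat.le_floor ?_
  rw [le_div_iff₀ hρ.a_pos, mul_comm]
  exact (hρ.mul_length_le w).trans hw

theorem cutWords_eq_wordsAt (hρ : WordWeight ρ a b A) {t : ℝ} (ht : 0 < t) :
    cutWords ρ t = wordsAt ρ t := by
  ext w
  refine ⟨fun h => ⟨h.2 ?_, h.1⟩, fun h => ⟨h.2, fun _ => h.1⟩⟩
  rintro rfl
  have := h.1
  rw [hρ.nil] at this
  linarith

theorem exists_append_mem_cutWords [Nonempty ι] (hρ : WordWeight ρ a b A) {t : ℝ} {w : List ι}
    (hw : w ≠ [] → ρ w.dropLast < t) : ∃ q, w ++ q ∈ cutWords ρ t := by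
  obtain ⟨n, hn⟩ := exists_nat_ge ((t - ρ w) / a)
  rw [div_le_iff₀ hρ.a_pos] at hn
  induction n generalizing w with
  | zero => exact ⟨[], by simp only [List.append_nil]; exact ⟨by simp at hn; linarith, hw⟩⟩
  | succ n ih =>
    rcases le_or_gt t (ρ w) with h | h
    · exact ⟨[], by simp only [List.append_nil]; exact ⟨h, hw⟩⟩
    · obtain ⟨i⟩ := ‹Nonempty ι›
      obtain ⟨q, hq⟩ := ih (w := w ++ [i]) (fun _ => by simpa using h) (by
        have h1 := hρ.superadd w [i]
        have h2 := hρ.le_letter i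
        push_cast at hn
        linarith)
      exact ⟨[i] ++ q, by rwa [← List.append_assoc]⟩

theorem cutWords_nonempty [Nonempty ι] (hρ : WordWeight ρ a b A) (t : ℝ) :
    (cutWords ρ t).Nonempty := by
  obtain ⟨q, hq⟩ := hρ.exists_append_mem_cutWords (t := t) (w := []) (fun h => absurd rfl h)
  exact ⟨_, hq⟩

theorem eq_of_append_eq (hρ : WordWeight ρ a b A) {t : ℝ} {p p' q q' : List ι}
    (hp : p ∈ cutWords ρ t) (hp' : p' ∈ cutWords ρ t) (h : p ++ q = p' ++ q') : p = p' := by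
  have key : ∀ {p r : List ι}, p ∈ cutWords ρ t → p ++ r ∈ cutWords ρ t → r = [] := by
    intro p r hp hpr
    by_contra hr
    have h1 := hpr.2 (by simp [hr])
    rw [List.dropLast_append_of_ne_nil hr] at h1
    linarith [hρ.le_append p r.dropLast, hp.1]
  rcases List.append_eq_append_iff.1 h with ⟨r, rfl, -⟩ | ⟨r, rfl, -⟩
  · rw [key hp hp', List.append_nil]
  · rw [key hp' hp, List.append_nil]

theorem le_of_mem_cutWords (hρ : WordWeight ρ a b A) {t : ℝ} {w : List ι}
    (hw : w ∈ cutWords ρ t) : ρ w ≤ max t 0 + b := by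
  have hb := hρ.b_nonneg
  induction w using List.reverseRecOn with
  | nil =>
    rw [hρ.nil]
    exact add_nonneg (le_max_right _ _) hb
  | append_singleton w i _ =>
    have h1 := hw.2 (by simp)
    rw [List.dropLast_concat] at h1
    linarith [hρ.append_letter_le w i, le_max_left t 0]

theorem finite_cutWords [Finite ι] (hρ : WordWeight ρ a b A) (t : ℝ) : (cutWords ρ t).Finite :=
  (hρ.finite_le (max t 0 + b)).subset fun _ hw => hρ.le_of_mem_cutWords hw

theorem one_le_ncard_cutWords [Finite ι] [Nonempty ι] (hρ : WordWeight ρ a b A) (t : ℝ) :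
    1 ≤ (cutWords ρ t).ncard :=
  (ncard_pos (hρ.finite_cutWords t)).2 (hρ.cutWords_nonempty t)

theorem ncard_cutWords_mono [Finite ι] [Nonempty ι] (hρ : WordWeight ρ a b A) :
    Monotone fun t => (cutWords ρ t).ncard := by
  intro s t hst
  choose! q hq using fun (w : List ι) (hw : w ∈ cutWords ρ s) =>
    hρ.exists_append_mem_cutWords (t := t) (fun h => (hw.2 h).trans_le hst)
  exact ncard_le_ncard_of_injOn (fun w => w ++ q w) hq
    (fun w hw w' hw' h => hρ.eq_of_append_eq hw hw' h) (hρ.finite_cutWords t)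

theorem exists_prefix_short (hρ : WordWeight ρ a b A) {s c : ℝ} {w : List ι} (h1 : s ≤ ρ w)
    (h2 : ρ w ≤ s + c) : ∃ p ∈ cutWords ρ s, ∃ q, ρ q ≤ c ∧ p ++ q = w := by
  obtain ⟨p, hp, q, rfl⟩ := exists_prefix_mem_cutWords h1
  exact ⟨p, hp, q, by linarith [hρ.superadd p q, hp.1], rfl⟩

theorem ncard_band_le [Finite ι] (hρ : WordWeight ρ a b A) (s c : ℝ) :
    {w | s ≤ ρ w ∧ ρ w ≤ s + c}.ncard ≤ (cutWords ρ s).ncard * {w | ρ w ≤ c}.ncard := by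
  refine (ncard_le_ncard ?_ ((hρ.finite_cutWords s).image2 (· ++ ·) (hρ.finite_le c))).trans
    ((hρ.finite_cutWords s).ncard_image2_le _ (hρ.finite_le c))
  rintro w ⟨h1, h2⟩
  obtain ⟨p, hp, q, hq, rfl⟩ := hρ.exists_prefix_short h1 h2
  exact mem_image2_of_mem hp hq

/-- The number of cut words is submultiplicative up to a constant: a word cut off at weight `s + t`
splits into a word cut off at weight `s` and a word of weight `t + O(1)`. -/
theorem exists_ncard_cutWords_add_le [Finite ι] [Nonempty ι] (hρ : WordWeight ρ a b A) :
    ∃ M : ℕ, 0 < M ∧ ∀ s t, 0 ≤ s → 0 ≤ t →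
      (cutWords ρ (s + t)).ncard ≤ M * ((cutWords ρ s).ncard * (cutWords ρ t).ncard) := by
  set c := b + (A + b) with hc
  have hA : 0 ≤ A := by
    have := hρ.superadd [] []
    have := hρ.subadd [] []
    simp only [List.append_nil, hρ.nil] at *
    linarith
  refine ⟨{w | ρ w ≤ c}.ncard, (ncard_pos (hρ.finite_le c)).2 ⟨[], ?_⟩, fun s t hs ht => ?_⟩
  · have := hρ.b_nonneg
    simp only [mem_ofPred_eq, hρ.nil]
    linarith
  have hfin : {w | t - (A + b) ≤ ρ w ∧ ρ w ≤ t - (A + b) + c}.Finite :=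
    (hρ.finite_le (t - (A + b) + c)).subset fun w hw => hw.2
  have h1 : (cutWords ρ (s + t)).ncard ≤
      (cutWords ρ s).ncard * {w | t - (A + b) ≤ ρ w ∧ ρ w ≤ t - (A + b) + c}.ncard := by
    refine (ncard_le_ncard ?_ ((hρ.finite_cutWords s).image2 (· ++ ·) hfin)).trans
      ((hρ.finite_cutWords s).ncard_image2_le _ hfin)
    intro w hw
    obtain ⟨p, hp, q, rfl⟩ := exists_prefix_mem_cutWords
      (ρ := ρ) (t := s) (w := w) (by linarith [hw.1])
    refine mem_image2_of_mem hp ⟨?_, ?_⟩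
    · have h2 := hρ.le_of_mem_cutWords hp
      rw [max_eq_left hs] at h2
      linarith [hw.1, hρ.subadd p q]
    · have h2 := hρ.le_of_mem_cutWords hw
      rw [max_eq_left (by linarith)] at h2
      linarith [hρ.superadd p q, hp.1]
  calc _ ≤ _ := h1
    _ ≤ (cutWords ρ s).ncard * ((cutWords ρ (t - (A + b))).ncard * {w | ρ w ≤ c}.ncard) :=
      Nat.mul_le_mul_left _ (hρ.ncard_band_le _ _)
    _ ≤ (cutWords ρ s).ncard * ((cutWords ρ t).ncard * {w | ρ w ≤ c}.ncard) :=
      Nat.mul_le_mul_left _ (Nat.mul_le_mul_right _ (hρ.ncard_cutWords_mono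
        (by linarith [hρ.b_nonneg])))
    _ = _ := by ring

theorem monotone_logb_ncard [Finite ι] [Nonempty ι] (hρ : WordWeight ρ a b A) :
    Monotone fun t => Real.logb 2 ((cutWords ρ t).ncard : ℝ) := fun _ _ hst =>
  Real.logb_le_logb_of_le one_lt_two (Nat.cast_pos.2 (hρ.one_le_ncard_cutWords _))
    (Nat.cast_le.2 (hρ.ncard_cutWords_mono hst))

theorem logb_ncard_nonneg [Finite ι] [Nonempty ι] (hρ : WordWeight ρ a b A) (t : ℝ) :
    0 ≤ Real.logb 2 ((cutWords ρ t).ncard : ℝ) :=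
  Real.logb_nonneg one_lt_two (Nat.one_le_cast.2 (hρ.one_le_ncard_cutWords t))

/-- The critical exponent exists, by Fekete's lemma. -/
theorem exists_tendsto_logb_ncard [Finite ι] [Nonempty ι] (hρ : WordWeight ρ a b A) :
    ∃ h, 0 ≤ h ∧
      Tendsto (fun u : ℝ => Real.logb 2 ((cutWords ρ u).ncard : ℝ) / u) atTop (𝓝 h) := by
  obtain ⟨M, hM, hadd⟩ := hρ.exists_ncard_cutWords_add_le
  set L : ℝ → ℝ := fun t => Real.logb 2 ((cutWords ρ t).ncard : ℝ) with hL
  have hL0 : ∀ t, 0 ≤ L t := hρ.logb_ncard_nonneg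
  have hM1 : 0 ≤ Real.logb 2 (M : ℝ) := Real.logb_nonneg one_lt_two (Nat.one_le_cast.2 hM)
  have hsub : Subadditive fun n : ℕ => L n + Real.logb 2 M := by
    intro m n
    have h1 : L (m + n) ≤ Real.logb 2 M + (L m + L n) := by
      have pos : ∀ t, ((cutWords ρ t).ncard : ℝ) ≠ 0 := fun t =>
        (Nat.cast_pos.2 (hρ.one_le_ncard_cutWords t)).ne'
      have h2 := Real.logb_le_logb_of_le one_lt_two
        (Nat.cast_pos.2 (hρ.one_le_ncard_cutWords (m + n)))
        (Nat.cast_le (α := ℝ).2 (hadd m n (Nat.cast_nonneg _) (Nat.cast_nonneg _)))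
      push_cast at h2
      rwa [Real.logb_mul (Nat.cast_pos.2 hM).ne' (mul_ne_zero (pos _) (pos _)),
        Real.logb_mul (pos _) (pos _)] at h2
    push_cast
    linarith
  have hbdd : BddBelow (range fun n : ℕ => (L n + Real.logb 2 M) / n) := by
    refine ⟨0, ?_⟩
    rintro _ ⟨n, rfl⟩
    exact div_nonneg (add_nonneg (hL0 _) hM1) (Nat.cast_nonneg _)
  set h := hsub.lim with hh
  have hlim0 : Tendsto (fun n : ℕ => L n / n) atTop (𝓝 h) := by
    have h1 := (hsub.tendsto_lim hbdd).sub (tendsto_const_div_atTop_nhds_zero_nat (Real.logb 2 M))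
    rw [sub_zero] at h1
    refine h1.congr fun n => ?_
    rw [← sub_div, add_sub_cancel_right]
  have hh0 : 0 ≤ h := ge_of_tendsto' hlim0 fun n => div_nonneg (hL0 _) (Nat.cast_nonneg _)
  refine ⟨h, hh0, ?_⟩
  -- Real arguments are compared with the neighbouring integers.
  have hfl : Tendsto (fun u : ℝ => L ⌊u⌋₊ / ⌊u⌋₊ * (⌊u⌋₊ / u)) atTop (𝓝 h) := by
    have := (hlim0.comp tendsto_nat_floor_atTop).mul (tendsto_nat_floor_div_atTop (R := ℝ))
    simpa using this
  have hce : Tendsto (fun u : ℝ => L ⌈u⌉₊ / ⌈u⌉₊ * (⌈u⌉₊ / u)) atTop (𝓝 h) := by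
    have := (hlim0.comp tendsto_nat_ceil_atTop).mul (tendsto_nat_ceil_div_atTop (R := ℝ))
    simpa using this
  refine tendsto_of_tendsto_of_tendsto_of_le_of_le' hfl hce ?_ ?_
  · filter_upwards [eventually_ge_atTop 1] with u hu
    have hpos : (0 : ℝ) < ⌊u⌋₊ := Nat.cast_pos.2 (Nat.floor_pos.2 hu)
    rw [div_mul_div_cancel₀ hpos.ne']
    have := hρ.monotone_logb_ncard (Nat.floor_le (zero_le_one.trans hu))
    exact div_le_div_of_nonneg_right this (by linarith)
  · filter_upwards [eventually_ge_atTop 1] with u hu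
    have hpos : (0 : ℝ) < ⌈u⌉₊ := Nat.cast_pos.2 (Nat.ceil_pos.2 (by linarith))
    rw [div_mul_div_cancel₀ hpos.ne']
    have := hρ.monotone_logb_ncard (Nat.le_ceil u)
    exact div_le_div_of_nonneg_right this (by linarith)

end WordWeight

/-! ### Powers of two in `[0, ∞]` -/

/-- The power `2 ^ t` as an extended non-negative real. -/
noncomputable def twoPow (t : ℝ) : ℝ≥0∞ := (2 : ℝ≥0∞) ^ t

theorem twoPow_add (s t : ℝ) : twoPow (s + t) = twoPow s * twoPow t :=
  ENNReal.rpow_add _ _ two_ne_zero ENNReal.ofNat_ne_top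

theorem twoPow_zero : twoPow 0 = 1 := ENNReal.rpow_zero

theorem twoPow_two : twoPow 2 = 4 := by
  rw [twoPow, ENNReal.rpow_ofNat]
  norm_num

theorem twoPow_ne_top (t : ℝ) : twoPow t ≠ ⊤ :=
  ENNReal.rpow_ne_top_of_ne_zero two_ne_zero ENNReal.ofNat_ne_top

theorem twoPow_eq_ofReal (t : ℝ) : twoPow t = ENNReal.ofReal (2 ^ t) := by
  rw [← ENNReal.ofReal_rpow_of_pos two_pos, ENNReal.ofReal_ofNat, twoPow]

theorem twoPow_strictMono : StrictMono twoPow := fun s t hst => by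
  rw [twoPow_eq_ofReal, twoPow_eq_ofReal]
  exact (ENNReal.ofReal_lt_ofReal_iff (by positivity)).2
    (Real.rpow_lt_rpow_of_exponent_lt one_lt_two hst)

theorem twoPow_mono : Monotone twoPow := twoPow_strictMono.monotone

theorem exists_eq_twoPow {c : ℝ≥0∞} (h0 : c ≠ 0) (hc : c ≠ ⊤) : ∃ t, c = twoPow t := by
  refine ⟨Real.logb 2 c.toReal, ?_⟩
  rw [twoPow_eq_ofReal, Real.rpow_logb two_pos (by norm_num) (ENNReal.toReal_pos h0 hc),
    ENNReal.ofReal_toReal hc]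

theorem exists_le_twoPow {c : ℝ≥0∞} (hc : c ≠ ⊤) : ∃ K, 0 ≤ K ∧ c ≤ twoPow K := by
  rcases eq_or_ne c 0 with rfl | h0
  · exact ⟨0, le_rfl, zero_le⟩
  · obtain ⟨t, rfl⟩ := exists_eq_twoPow h0 hc
    exact ⟨max t 0, le_max_right _ _, twoPow_mono (le_max_left _ _)⟩

theorem natCast_le_twoPow {n : ℕ} {t : ℝ} (h : Real.logb 2 n ≤ t) : (n : ℝ≥0∞) ≤ twoPow t := by
  rcases n.eq_zero_or_pos with rfl | hn
  · simp
  · rw [twoPow_eq_ofReal, ← ENNReal.ofReal_natCast]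
    exact ENNReal.ofReal_le_ofReal
      ((Real.logb_le_iff_le_rpow one_lt_two (Nat.cast_pos.2 hn)).1 h)

theorem twoPow_le_natCast {n : ℕ} {t : ℝ} (hn : 0 < n) (h : t ≤ Real.logb 2 n) :
    twoPow t ≤ (n : ℝ≥0∞) := by
  rw [twoPow_eq_ofReal, ← ENNReal.ofReal_natCast]
  exact ENNReal.ofReal_le_ofReal
    ((Real.le_logb_iff_rpow_le one_lt_two (Nat.cast_pos.2 hn)).1 h)

theorem tsum_twoPow_neg_ne_top {ε : ℝ} (hε : 0 < ε) : ∑' n : ℕ, twoPow (-(ε * n)) ≠ ⊤ := by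
  have h : ∀ n : ℕ, twoPow (-(ε * n)) = twoPow (-ε) ^ n := fun n => by
    rw [twoPow, twoPow, ← ENNReal.rpow_mul_natCast, neg_mul]
  simp_rw [h, ENNReal.tsum_geometric]
  refine ENNReal.inv_ne_top.2 (tsub_pos_of_lt ?_).ne'
  rw [← twoPow_zero]
  exact twoPow_strictMono (neg_lt_zero.2 hε)

/-! ### Counting words -/

theorem Set.encard_image2_le {β γ δ : Type*} (f : β → γ → δ) (s : Set β) (t : Set γ) :
    (image2 f s t).encard ≤ s.encard * t.encard := by
  rw [← image_uncurry_prod, ← encard_prod]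
  exact encard_image_le _ _

theorem wordMap_append {X ι : Type*} (f : ι → X → X) (w w' : List ι) :
    wordMap f (w ++ w') = wordMap f w ∘ wordMap f w' := by
  induction w with
  | nil => rfl
  | cons i w ih => rw [List.cons_append, wordMap, ih, wordMap, Function.comp_assoc]

theorem range_wordMap_append_subset {X ι : Type*} (f : ι → X → X) (w w' : List ι) :
    range (wordMap f (w ++ w')) ⊆ range (wordMap f w) := by
  rw [wordMap_append]
  exact range_comp_subset_range _ _

/-- The words cut off at weight `t` whose cylinder meets the ball `B(x, 2 ^ (-t))`; it is
`wordsNear f ρ x t` for `t > 0`. -/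
def cutWordsNear {X ι : Type*} [MetricSpace X] (f : ι → X → X) (ρ : List ι → ℝ) (x : X) (t : ℝ) :
    Set (List ι) :=
  {w ∈ cutWords ρ t | (range (wordMap f w) ∩ Metric.ball x ((2 : ℝ) ^ (-t))).Nonempty}

namespace WordWeight

variable {X ι : Type*} [MetricSpace X] {f : ι → X → X} {ρ : List ι → ℝ} {a b A h : ℝ}

theorem exists_ncard_le_twoPow [Finite ι] [Nonempty ι] (hρ : WordWeight ρ a b A) (h0 : 0 ≤ h)
    (hh : Tendsto (fun u : ℝ => Real.logb 2 ((cutWords ρ u).ncard : ℝ) / u) atTop (𝓝 h))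
    {ε : ℝ} (hε : 0 < ε) :
    ∃ K, 0 ≤ K ∧ ∀ u, 0 ≤ u → ((cutWords ρ u).ncard : ℝ≥0∞) ≤ twoPow ((h + ε) * u + K) := by
  obtain ⟨K, hK, H⟩ := (hρ.monotone_logb_ncard.monotoneOn _).exists_le_of_tendsto_div hh h0 hε
  exact ⟨K, hK, fun u hu => natCast_le_twoPow (H u hu)⟩

theorem exists_twoPow_le_ncard [Finite ι] [Nonempty ι] (hρ : WordWeight ρ a b A) (h0 : 0 ≤ h)
    (hh : Tendsto (fun u : ℝ => Real.logb 2 ((cutWords ρ u).ncard : ℝ) / u) atTop (𝓝 h))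
    {ε : ℝ} (hε : 0 < ε) :
    ∃ K, 0 ≤ K ∧ ∀ u, 0 ≤ u → twoPow ((h - ε) * u - K) ≤ ((cutWords ρ u).ncard : ℝ≥0∞) := by
  obtain ⟨K, hK, H⟩ := exists_ge_of_tendsto_div (fun u _ => hρ.logb_ncard_nonneg u) hh h0 hε
  exact ⟨K, hK, fun u hu => twoPow_le_natCast (hρ.one_le_ncard_cutWords u) (H u hu)⟩

/-- The Poincaré series of the weight converges above the critical exponent. -/
theorem tsum_twoPow_ne_top [Finite ι] [Nonempty ι] (hρ : WordWeight ρ a b A) (h0 : 0 ≤ h)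
    (hh : Tendsto (fun u : ℝ => Real.logb 2 ((cutWords ρ u).ncard : ℝ) / u) atTop (𝓝 h))
    {H : ℝ} (hH : h < H) : ∑' w, twoPow (-(H * ρ w)) ≠ ⊤ := by
  have hε : 0 < (H - h) / 2 := by linarith
  obtain ⟨K, -, hK⟩ := hρ.exists_ncard_le_twoPow h0 hh hε
  set M : ℝ≥0∞ := ({w | ρ w ≤ 1}.ncard : ℝ≥0∞) with hM
  set band : ℕ → Set (List ι) := fun n => {w | (n : ℝ) ≤ ρ w ∧ ρ w ≤ n + 1} with hband
  have hcover : (⋃ n, band n) = univ := by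
    refine eq_univ_of_forall fun w => mem_iUnion.2 ⟨⌊ρ w⌋₊, ?_, ?_⟩
    · exact Nat.floor_le (hρ.nonneg w)
    · exact (Nat.lt_floor_add_one _).le
  have h1 : ∑' w, twoPow (-(H * ρ w)) ≤ ∑' n, ∑' w : band n, twoPow (-(H * ρ w)) := by
    rw [← tsum_univ, ← hcover]
    exact ENNReal.tsum_iUnion_le_tsum (fun w => twoPow (-(H * ρ w))) band
  have h2 : ∀ n : ℕ, ∑' w : band n, twoPow (-(H * ρ w)) ≤
      M * twoPow K * twoPow (-((H - h) / 2 * n)) := fun n => by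
    calc ∑' w : band n, twoPow (-(H * ρ w)) ≤ ∑' _ : band n, twoPow (-(H * n)) :=
          ENNReal.tsum_le_tsum fun w => twoPow_mono (neg_le_neg
            (mul_le_mul_of_nonneg_left w.2.1 (by linarith)))
      _ = (band n).encard * twoPow (-(H * n)) := ENNReal.tsum_set_const _ _
      _ ≤ (twoPow ((h + (H - h) / 2) * n + K) * M) * twoPow (-(H * n)) := by
        gcongr
        have hfin : (band n).Finite := (hρ.finite_le (n + 1)).subset fun w hw => hw.2
        rw [← hfin.cast_ncard_eq, ENat.toENNReal_coe]
        refine (Nat.cast_le.2 (hρ.ncard_band_le n 1)).trans ?_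
        push_cast
        gcongr
        exact hK n n.cast_nonneg
      _ = M * (twoPow ((h + (H - h) / 2) * n + K) * twoPow (-(H * n))) := by ring
      _ = M * (twoPow K * twoPow (-((H - h) / 2 * n))) := by
        rw [← twoPow_add, ← twoPow_add]
        congr 2
        ring
      _ = _ := by ring
  refine ne_top_of_le_ne_top ?_ (h1.trans (ENNReal.tsum_le_tsum h2))
  rw [ENNReal.tsum_mul_left]
  exact ENNReal.mul_ne_top (ENNReal.mul_ne_top (ENNReal.natCast_ne_top _) (twoPow_ne_top _))
    (tsum_twoPow_neg_ne_top hε)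

/-- Asymptotic boundedness, as a bound for all scales. -/
theorem exists_encard_cutWordsNear_le [Finite ι] [Nonempty ι] (hρ : WordWeight ρ a b A)
    (hb : AsymptoticallyBounded f ρ) {ε : ℝ} (hε : 0 < ε) :
    ∃ K, 0 ≤ K ∧ ∀ x t, ((cutWordsNear f ρ x t).encard : ℝ≥0∞) ≤ twoPow (ε * max t 0 + K) := by
  obtain ⟨U, hU⟩ := eventually_atTop.1 (hb.eventually (gt_mem_nhds hε))
  obtain ⟨K, hK, hNK⟩ := exists_le_twoPow
    (ENNReal.natCast_ne_top ((cutWords ρ (max U 1)).ncard))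
  refine ⟨K, hK, fun x t => ?_⟩
  have hsub : cutWordsNear f ρ x t ⊆ cutWords ρ t := fun w hw => hw.1
  rw [← ((hρ.finite_cutWords t).subset hsub).cast_ncard_eq, ENat.toENNReal_coe]
  rcases le_total (max U 1) t with h1 | h1
  · have ht0 : 0 < t := lt_of_lt_of_le one_pos ((le_max_right _ _).trans h1)
    have heq : ∀ y, cutWordsNear f ρ y t = wordsNear f ρ y t := fun y => by
      rw [cutWordsNear, wordsNear, hρ.cutWords_eq_wordsAt ht0]
    have h2 := (div_lt_iff₀ ht0).1 (hU t ((le_max_left _ _).trans h1))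
    rw [max_eq_left ht0.le, heq]
    have hbdd : BddAbove (range fun y : X => ((wordsNear f ρ y t).ncard : ℝ)) := by
      refine ⟨(cutWords ρ t).ncard, ?_⟩
      rintro _ ⟨y, rfl⟩
      simp only
      rw [← heq y]
      exact Nat.cast_le.2 (ncard_le_ncard (fun w hw => hw.1) (hρ.finite_cutWords t))
    have h3 := le_ciSup hbdd x
    rcases (wordsNear f ρ x t).ncard.eq_zero_or_pos with h4 | h4
    · rw [h4, Nat.cast_zero]
      exact zero_le
    · have h5 := Real.logb_le_logb_of_le one_lt_two (Nat.cast_pos.2 h4) h3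
      exact natCast_le_twoPow (by linarith)
  · have h2 : (cutWordsNear f ρ x t).ncard ≤ (cutWords ρ (max U 1)).ncard :=
      (ncard_le_ncard hsub (hρ.finite_cutWords t)).trans (hρ.ncard_cutWords_mono h1)
    refine (Nat.cast_le.2 h2).trans (hNK.trans (twoPow_mono ?_))
    have : 0 ≤ ε * max t 0 := by positivity
    linarith

theorem exists_prefix_near (hρ : WordWeight ρ a b A) {s c : ℝ} {x : X} {w : List ι}
    (h1 : s ≤ ρ w) (h2 : ρ w ≤ s + c)
    (hw : (range (wordMap f w) ∩ Metric.ball x ((2 : ℝ) ^ (-s))).Nonempty) :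
    ∃ p ∈ cutWordsNear f ρ x s, ∃ q, ρ q ≤ c ∧ p ++ q = w := by
  obtain ⟨p, hp, q, hq, rfl⟩ := hρ.exists_prefix_short h1 h2
  exact ⟨p, ⟨hp, hw.mono (inter_subset_inter_left _ (range_wordMap_append_subset f p q))⟩, q, hq,
    rfl⟩

/-- The words of weight about `s` whose cylinder meets `B(x, 2 ^ (-s))`. -/
theorem encard_near_band_le (hρ : WordWeight ρ a b A) (x : X) (s c : ℝ) :
    {w | (s ≤ ρ w ∧ ρ w ≤ s + c) ∧
      (range (wordMap f w) ∩ Metric.ball x ((2 : ℝ) ^ (-s))).Nonempty}.encard ≤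
    (cutWordsNear f ρ x s).encard * {w | ρ w ≤ c}.encard := by
  refine (encard_le_encard ?_).trans (encard_image2_le (· ++ ·) _ _)
  rintro w ⟨⟨h1, h2⟩, h3⟩
  obtain ⟨p, hp, q, hq, rfl⟩ := hρ.exists_prefix_near h1 h2 h3
  exact mem_image2_of_mem hp hq

/-- There are `2 ^ o(v)` cylinders of size at least `2 ^ (-v)` that meet a given ball of radius
`2 ^ (-v)`. -/
theorem exists_encard_large_le [Finite ι] [Nonempty ι] (hρ : WordWeight ρ a b A)
    (hb : AsymptoticallyBounded f ρ) {ε : ℝ} (hε : 0 < ε) :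
    ∃ K, 0 ≤ K ∧ ∀ x v, 0 ≤ v → ({w | ρ w ≤ v ∧
      (range (wordMap f w) ∩ Metric.ball x ((2 : ℝ) ^ (-v))).Nonempty}.encard : ℝ≥0∞) ≤
        twoPow (ε * v + K) := by
  have hε2 : 0 < ε / 2 := half_pos hε
  obtain ⟨K, hK, hnear⟩ := hρ.exists_encard_cutWordsNear_le hb hε2
  set M : ℝ≥0∞ := ({w | ρ w ≤ 1}.encard : ℝ≥0∞) with hM
  have hMtop : M ≠ ⊤ := by
    rw [hM, ← (hρ.finite_le 1).cast_ncard_eq, ENat.toENNReal_coe]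
    exact ENNReal.natCast_ne_top _
  obtain ⟨K', hK', hc⟩ := exists_le_twoPow (ENNReal.mul_ne_top (ENNReal.mul_ne_top
    (twoPow_ne_top K) hMtop) (tsum_twoPow_neg_ne_top hε2))
  refine ⟨K', hK', fun x v hv => ?_⟩
  set W := {w | ρ w ≤ v ∧ (range (wordMap f w) ∩ Metric.ball x ((2 : ℝ) ^ (-v))).Nonempty} with hW
  set band : ℕ → Set (List ι) := fun n => {w | (((n : ℝ) ≤ ρ w ∧ ρ w ≤ n + 1) ∧
      (range (wordMap f w) ∩ Metric.ball x ((2 : ℝ) ^ (-(n : ℝ)))).Nonempty) ∧ (n : ℝ) ≤ v}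
    with hband
  have hcover : W ⊆ ⋃ n, band n := fun w hw => by
    have h1 := Nat.floor_le (hρ.nonneg w)
    have h2 := h1.trans hw.1
    refine mem_iUnion.2 ⟨⌊ρ w⌋₊, ⟨⟨h1, (Nat.lt_floor_add_one _).le⟩, ?_⟩, h2⟩
    exact hw.2.mono (inter_subset_inter_right _ (Metric.ball_subset_ball
      (Real.rpow_le_rpow_of_exponent_le one_le_two (neg_le_neg h2))))
  have hterm : ∀ n : ℕ, ((band n).encard : ℝ≥0∞) ≤
      twoPow (ε * v) * (twoPow K * M) * twoPow (-(ε / 2 * n)) := fun n => by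
    rcases le_or_gt (n : ℝ) v with hn | hn
    · have h1 : (band n).encard ≤ (cutWordsNear f ρ x n).encard * {w | ρ w ≤ 1}.encard :=
        (encard_le_encard fun w hw => hw.1).trans (hρ.encard_near_band_le x n 1)
      refine (ENat.toENNReal_le.2 h1).trans ?_
      rw [ENat.toENNReal_mul]
      calc _ ≤ twoPow (ε / 2 * max (n : ℝ) 0 + K) * M := by gcongr; exact hnear x n
        _ ≤ twoPow (ε * v + K + -(ε / 2 * n)) * M := by
          gcongr
          refine twoPow_mono ?_
          rw [max_eq_left n.cast_nonneg]
          nlinarith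
        _ = _ := by rw [twoPow_add, twoPow_add]; ring
    · have : band n = ∅ := eq_empty_of_forall_notMem fun w hw => hn.not_ge hw.2
      rw [this]
      simp
  calc (W.encard : ℝ≥0∞) = ∑' _ : W, (1 : ℝ≥0∞) := (ENNReal.tsum_set_one W).symm
    _ ≤ ∑' _ : ⋃ n, band n, (1 : ℝ≥0∞) := ENNReal.tsum_mono_subtype (fun _ => 1) hcover
    _ ≤ ∑' n, ∑' _ : band n, (1 : ℝ≥0∞) := ENNReal.tsum_iUnion_le_tsum (fun _ => 1) band
    _ ≤ ∑' n : ℕ, twoPow (ε * v) * (twoPow K * M) * twoPow (-(ε / 2 * n)) :=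
      ENNReal.tsum_le_tsum fun n => (ENNReal.tsum_set_one (band n)).trans_le (hterm n)
    _ = twoPow (ε * v) * (twoPow K * M * ∑' n : ℕ, twoPow (-(ε / 2 * n))) := by
      rw [ENNReal.tsum_mul_left, mul_assoc]
    _ ≤ twoPow (ε * v) * twoPow K' := by gcongr
    _ = twoPow (ε * v + K') := (twoPow_add _ _).symm

/-- The contribution to the Poincaré series of the words of weight at least `s` whose cylinder meets
`B(x, 2 ^ (-s))`. -/
theorem tsum_near_le (hρ : WordWeight ρ a b A) {H : ℝ} (hH : 0 ≤ H) (x : X) (s : ℝ) :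
    ∑' w : {w | s ≤ ρ w ∧ (range (wordMap f w) ∩ Metric.ball x ((2 : ℝ) ^ (-s))).Nonempty},
      twoPow (-(H * ρ w)) ≤
    (cutWordsNear f ρ x s).encard * (twoPow (-(H * s)) * ∑' w, twoPow (-(H * ρ w))) := by
  set W := {w | s ≤ ρ w ∧ (range (wordMap f w) ∩ Metric.ball x ((2 : ℝ) ^ (-s))).Nonempty} with hW
  have hcover : W ⊆ ⋃ p ∈ cutWordsNear f ρ x s, range (p ++ ·) := fun w hw => by
    obtain ⟨p, hp, q, -, rfl⟩ := hρ.exists_prefix_near (c := ρ w - s) hw.1 (by linarith) hw.2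
    exact mem_biUnion hp ⟨q, rfl⟩
  have hterm : ∀ p : cutWordsNear f ρ x s, ∑' w : range (p.1 ++ ·), twoPow (-(H * ρ w)) ≤
      twoPow (-(H * s)) * ∑' w, twoPow (-(H * ρ w)) := fun p => by
    refine (ENNReal.tsum_le_tsum_comp_of_surjective (rangeFactorization_surjective
      (f := fun q => p.1 ++ q)) _).trans ?_
    rw [← ENNReal.tsum_mul_left]
    refine ENNReal.tsum_le_tsum fun q => ?_
    rw [← twoPow_add]
    refine twoPow_mono ?_
    have h1 : s + ρ q ≤ ρ (p.1 ++ q) := (add_le_add_left p.2.1.1 _).trans (hρ.superadd _ _)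
    have h2 := mul_le_mul_of_nonneg_left h1 hH
    simp only [rangeFactorization_coe]
    linarith
  calc ∑' w : W, twoPow (-(H * ρ w))
    _ ≤ ∑' w : ⋃ p ∈ cutWordsNear f ρ x s, range (p ++ ·), twoPow (-(H * ρ w)) :=
      ENNReal.tsum_mono_subtype (fun w => twoPow (-(H * ρ w))) hcover
    _ ≤ ∑' p : cutWordsNear f ρ x s, ∑' w : range (p.1 ++ ·), twoPow (-(H * ρ w)) :=
      ENNReal.tsum_biUnion_le_tsum (fun w => twoPow (-(H * ρ w))) _ (fun p => range (p ++ ·))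
    _ ≤ ∑' _ : cutWordsNear f ρ x s, twoPow (-(H * s)) * ∑' w, twoPow (-(H * ρ w)) :=
      ENNReal.tsum_le_tsum hterm
    _ = _ := ENNReal.tsum_set_const _ _

end WordWeight

/-! ### Covering numbers -/

section CoverNum

variable {X : Type*} [MetricSpace X]

theorem coverNum_le_encard {r : ℝ} {A C : Set X} (h : A ⊆ ⋃ c ∈ C, Metric.ball c r) :
    coverNum r A ≤ C.encard :=
  iInf₂_le C h

theorem le_coverNum {r : ℝ} {A : Set X} {n : ℕ∞}
    (h : ∀ C : Set X, A ⊆ ⋃ c ∈ C, Metric.ball c r → n ≤ C.encard) : n ≤ coverNum r A :=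
  le_iInf₂ h

theorem exists_cover {r : ℝ} (hr : 0 < r) (A : Set X) :
    ∃ C : Set X, A ⊆ ⋃ c ∈ C, Metric.ball c r ∧ C.encard = coverNum r A := by
  have hne : {C : Set X | A ⊆ ⋃ c ∈ C, Metric.ball c r}.Nonempty :=
    ⟨univ, fun x _ => mem_biUnion (mem_univ x) (Metric.mem_ball_self hr)⟩
  have h : coverNum r A = sInf (encard '' {C : Set X | A ⊆ ⋃ c ∈ C, Metric.ball c r}) := by
    rw [sInf_image]
    rfl
  obtain ⟨C, hC, hCe⟩ := csInf_mem (hne.image encard)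
  exact ⟨C, hC, hCe.trans h.symm⟩

theorem coverNum_empty (r : ℝ) : coverNum r (∅ : Set X) = 0 :=
  nonpos_iff_eq_zero.1 ((coverNum_le_encard (C := ∅) (empty_subset _)).trans encard_empty.le)

theorem coverNum_mono {r : ℝ} {A B : Set X} (h : A ⊆ B) : coverNum r A ≤ coverNum r B :=
  le_coverNum fun _ hC => coverNum_le_encard (h.trans hC)

theorem coverNum_anti {r s : ℝ} (h : r ≤ s) (A : Set X) : coverNum s A ≤ coverNum r A :=
  le_coverNum fun _ hC => coverNum_le_encard
    (hC.trans (iUnion₂_mono fun _ _ => Metric.ball_subset_ball h))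

theorem coverNum_iUnion_le {r : ℝ} (hr : 0 < r) {κ : Type*} (A : κ → Set X) :
    (coverNum r (⋃ i, A i) : ℝ≥0∞) ≤ ∑' i, (coverNum r (A i) : ℝ≥0∞) := by
  choose C hC hCe using fun i => exists_cover hr (A i)
  have h1 : coverNum r (⋃ i, A i) ≤ (⋃ i, C i).encard :=
    coverNum_le_encard (iUnion_subset fun i => (hC i).trans
      (biUnion_subset_biUnion_left (subset_iUnion C i)))
  refine (ENat.toENNReal_le.2 h1).trans ?_
  rw [← ENNReal.tsum_set_one]
  refine (ENNReal.tsum_iUnion_le_tsum (fun _ => 1) C).trans (ENNReal.tsum_le_tsum fun i => ?_)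
  rw [ENNReal.tsum_set_one, hCe]

theorem coverNum_union_le {r : ℝ} (hr : 0 < r) (A B : Set X) :
    coverNum r (A ∪ B) ≤ coverNum r A + coverNum r B := by
  obtain ⟨C, hC, hCe⟩ := exists_cover hr A
  obtain ⟨D, hD, hDe⟩ := exists_cover hr B
  rw [← hCe, ← hDe]
  refine (coverNum_le_encard ?_).trans (encard_union_le C D)
  exact union_subset (hC.trans (biUnion_subset_biUnion_left subset_union_left))
    (hD.trans (biUnion_subset_biUnion_left subset_union_right))

/-- Covers at scale `r` are obtained from covers at scale `R` by covering each ball separately. -/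
theorem coverNum_le_mul {r R : ℝ} (hr : 0 < r) (hR : 0 < R) {A : Set X} {c : ℝ≥0∞}
    (h : ∀ x, (coverNum r (A ∩ Metric.ball x R) : ℝ≥0∞) ≤ c) :
    (coverNum r A : ℝ≥0∞) ≤ coverNum R A * c := by
  obtain ⟨C, hC, hCe⟩ := exists_cover hR A
  have h1 : A ⊆ ⋃ x : C, A ∩ Metric.ball x.1 R := fun y hy => by
    obtain ⟨x, hx, hxy⟩ := mem_iUnion₂.1 (hC hy)
    exact mem_iUnion.2 ⟨⟨x, hx⟩, hy, hxy⟩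
  calc (coverNum r A : ℝ≥0∞) ≤ coverNum r (⋃ x : C, A ∩ Metric.ball x.1 R) :=
        ENat.toENNReal_le.2 (coverNum_mono h1)
    _ ≤ ∑' x : C, (coverNum r (A ∩ Metric.ball x.1 R) : ℝ≥0∞) := coverNum_iUnion_le hr _
    _ ≤ ∑' _ : C, c := ENNReal.tsum_le_tsum fun x => h x
    _ = coverNum R A * c := by rw [ENNReal.tsum_set_const, hCe]

theorem coverNum_image_val_le {E : Set X} {r : ℝ} (S : Set E) :
    coverNum r (Subtype.val '' S) ≤ coverNum r S := by
  refine le_coverNum fun C hC => ?_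
  refine (coverNum_le_encard (C := Subtype.val '' C) ?_).trans (encard_image_le _ _)
  rintro _ ⟨y, hy, rfl⟩
  obtain ⟨x, hx, hxy⟩ := mem_iUnion₂.1 (hC hy)
  exact mem_biUnion (mem_image_of_mem _ hx) hxy

/-- Moving the centres of a cover into a subspace doubles the radius. -/
theorem coverNum_two_mul_le {E : Set X} {r : ℝ} (S : Set E) :
    coverNum (2 * r) S ≤ coverNum r (Subtype.val '' S) := by
  refine le_coverNum fun C hC => ?_
  rcases S.eq_empty_or_nonempty with rfl | ⟨y₀, -⟩
  · rw [coverNum_empty]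
    exact zero_le
  have : Nonempty E := ⟨y₀⟩
  choose! g hg using fun (c : X) (h : ∃ y : E, dist (y : X) c < r) => h
  refine (coverNum_le_encard (C := g '' C) fun y hy => ?_).trans (encard_image_le _ _)
  obtain ⟨x, hx, hxy⟩ := mem_iUnion₂.1 (hC (mem_image_of_mem _ hy))
  refine mem_biUnion (mem_image_of_mem _ hx) ?_
  have h1 := hg x ⟨y, hxy⟩
  rw [Metric.mem_ball] at hxy ⊢
  have h2 := dist_triangle_right (y : X) (g x : X) x
  rw [Subtype.dist_eq]
  linarith

end CoverNum

theorem coverNum_ne_top {X : Type*} [MetricSpace X] [CompactSpace X] {r : ℝ} (hr : 0 < r)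
    (A : Set X) : (coverNum r A : ℝ≥0∞) ≠ ⊤ := by
  obtain ⟨C, -, hC⟩ := isCompact_univ.elim_finite_subcover_image (b := univ)
    (c := fun x : X => Metric.ball x r) (fun x _ => Metric.isOpen_ball)
    (fun x _ => mem_biUnion (mem_univ x) (Metric.mem_ball_self hr))
  have h1 : coverNum r A ≤ C.encard := coverNum_le_encard ((subset_univ A).trans hC.2)
  rw [Ne, ENat.toENNReal_eq_top]
  exact ne_top_of_le_ne_top (encard_ne_top_iff.2 hC.1) h1

/-! ### The logarithm in base two -/

theorem log2_mono : Monotone log2 := fun m n h => by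
  refine ENNReal.div_le_div_right (EReal.toENNReal_le_toENNReal ?_) _
  exact ENNReal.log_le_log (ENat.toENNReal_le.2 h)

theorem log_twoPow_div (t : ℝ) :
    (ENNReal.log (twoPow t)).toENNReal / ENNReal.ofReal (Real.log 2) = ENNReal.ofReal t := by
  have hlog : 0 < Real.log 2 := Real.log_pos one_lt_two
  rw [twoPow_eq_ofReal, ENNReal.log_ofReal_of_pos (by positivity), Real.log_rpow two_pos,
    EReal.toENNReal_of_ne_top (EReal.coe_ne_top _), EReal.toReal_coe, ENNReal.ofReal_mul' hlog.le,
    ENNReal.mul_div_cancel_right (by simpa using hlog) ENNReal.ofReal_ne_top]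

theorem log2_le {n : ℕ∞} {t : ℝ} (h : (n : ℝ≥0∞) ≤ twoPow t) : log2 n ≤ ENNReal.ofReal t := by
  rw [← log_twoPow_div]
  exact ENNReal.div_le_div_right (EReal.toENNReal_le_toENNReal (ENNReal.log_le_log h)) _

theorem le_log2 {n : ℕ∞} {t : ℝ} (h : twoPow t ≤ (n : ℝ≥0∞)) : ENNReal.ofReal t ≤ log2 n := by
  rw [← log_twoPow_div]
  exact ENNReal.div_le_div_right (EReal.toENNReal_le_toENNReal (ENNReal.log_le_log h)) _

theorem le_twoPow_of_log2_le {n : ℕ∞} {t : ℝ} (ht : 0 ≤ t) (h : log2 n ≤ ENNReal.ofReal t) :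
    (n : ℝ≥0∞) ≤ twoPow t := by
  by_contra! hn
  obtain ⟨s, hs, hsn⟩ : ∃ s, t < s ∧ twoPow s ≤ (n : ℝ≥0∞) := by
    rcases eq_or_ne (n : ℝ≥0∞) ⊤ with h1 | h1
    · exact ⟨t + 1, by linarith, h1 ▸ le_top⟩
    · obtain ⟨s, hs⟩ := exists_eq_twoPow (ne_bot_of_gt hn) h1
      refine ⟨s, ?_, hs.ge⟩
      rwa [hs, twoPow_strictMono.lt_iff_lt] at hn
  exact ((ENNReal.ofReal_lt_ofReal_iff (ht.trans_lt hs)).2 hs).not_ge ((le_log2 hsn).trans h)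

/-! ### Branching functions of metric spaces -/

section Branching

variable {X : Type*} [MetricSpace X]

theorem branching_le {u v t : ℝ}
    (h : ∀ x : X, (coverNum ((2 : ℝ) ^ (-u)) (Metric.ball x ((2 : ℝ) ^ (-v))) : ℝ≥0∞) ≤ twoPow t) :
    branching X u v ≤ ENNReal.ofReal t := by
  refine log2_le ?_
  rw [ENat.toENNReal_iSup]
  exact iSup_le h

theorem coverNum_ball_le_twoPow {u v t : ℝ} (ht : 0 ≤ t) (h : branching X u v ≤ ENNReal.ofReal t)
    (x : X) :
    (coverNum ((2 : ℝ) ^ (-u)) (Metric.ball x ((2 : ℝ) ^ (-v))) : ℝ≥0∞) ≤ twoPow t :=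
  le_twoPow_of_log2_le ht ((log2_mono (le_iSup
    (fun x : X => coverNum ((2 : ℝ) ^ (-u)) (Metric.ball x ((2 : ℝ) ^ (-v)))) x)).trans h)

theorem le_branching {u v t : ℝ} (x : X)
    (h : twoPow t ≤ (coverNum ((2 : ℝ) ^ (-u)) (Metric.ball x ((2 : ℝ) ^ (-v))) : ℝ≥0∞)) :
    ENNReal.ofReal t ≤ branching X u v :=
  (le_log2 h).trans (log2_mono (le_iSup
    (fun x : X => coverNum ((2 : ℝ) ^ (-u)) (Metric.ball x ((2 : ℝ) ^ (-v)))) x))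

theorem two_rpow_neg_le {u u' : ℝ} (h : u ≤ u') : (2 : ℝ) ^ (-u') ≤ (2 : ℝ) ^ (-u) :=
  Real.rpow_le_rpow_of_exponent_le one_le_two (neg_le_neg h)

theorem two_rpow_neg_pos (u : ℝ) : 0 < (2 : ℝ) ^ (-u) := Real.rpow_pos_of_pos two_pos _

theorem two_mul_two_rpow_neg (u : ℝ) : 2 * (2 : ℝ) ^ (-(u + 1)) = (2 : ℝ) ^ (-u) := by
  rw [show -u = 1 + -(u + 1) by ring, Real.rpow_add two_pos, Real.rpow_one]

theorem branching_anti_right (u : ℝ) {v v' : ℝ} (h : v ≤ v') : branching X u v' ≤ branching X u v :=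
  log2_mono (iSup_mono fun _ => coverNum_mono (Metric.ball_subset_ball (two_rpow_neg_le h)))

theorem branching_mono_left {u u' : ℝ} (h : u ≤ u') (v : ℝ) : branching X u v ≤ branching X u' v :=
  log2_mono (iSup_mono fun _ => coverNum_anti (two_rpow_neg_le h) _)

/-- Passing to a subspace costs one unit of scale, since centres have to be moved into it. -/
theorem branching_le_of_subset {E G : Set X} (h : E ⊆ G) (u v : ℝ) :
    branching E u v ≤ branching G (u + 1) v := by
  refine log2_mono (iSup_le fun x => ?_)
  refine le_trans ?_ (le_iSup (fun y : G =>
    coverNum ((2 : ℝ) ^ (-(u + 1))) (Metric.ball y ((2 : ℝ) ^ (-v)))) ⟨x, h x.2⟩)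
  rw [← two_mul_two_rpow_neg u]
  refine (coverNum_two_mul_le _).trans (le_trans (coverNum_mono ?_) (coverNum_image_val_le _))
  rintro _ ⟨y, hy, rfl⟩
  exact ⟨⟨y, h y.2⟩, hy, rfl⟩

/-- A subset of `E` within `2 ^ (-v)` of one of its points is covered, inside the ambient space, by
at most `2 ^ t` balls, if `β_E(u, v) ≤ t`. -/
theorem coverNum_le_twoPow_of_branching {E S : Set X} {u v t : ℝ} (ht : 0 ≤ t)
    (h : branching E u v ≤ ENNReal.ofReal t) {x : X} (hx : x ∈ E) (hS : S ⊆ E)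
    (hSx : S ⊆ Metric.ball x ((2 : ℝ) ^ (-v))) :
    (coverNum ((2 : ℝ) ^ (-u)) S : ℝ≥0∞) ≤ twoPow t := by
  refine le_trans (ENat.toENNReal_le.2 ?_) (coverNum_ball_le_twoPow ht h ⟨x, hx⟩)
  refine (coverNum_mono ?_).trans (coverNum_image_val_le _)
  intro y hy
  exact ⟨⟨y, hS hy⟩, hSx hy, rfl⟩

/-- `β_E(u, v) ≤ t` follows from covers, inside the ambient space, by balls of half the radius. -/
theorem branching_le_of_coverNum {E : Set X} {u v t : ℝ}
    (h : ∀ x ∈ E, (coverNum ((2 : ℝ) ^ (-(u + 1))) (Metric.ball x ((2 : ℝ) ^ (-v)) ∩ E) : ℝ≥0∞) ≤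
      twoPow t) : branching E u v ≤ ENNReal.ofReal t := by
  refine branching_le fun x => (ENat.toENNReal_le.2 ?_).trans (h x x.2)
  rw [← two_mul_two_rpow_neg u]
  refine (coverNum_two_mul_le _).trans (coverNum_mono ?_)
  rintro _ ⟨y, hy, rfl⟩
  exact ⟨hy, y.2⟩

end Branching

/-! ### Spectra and linear bounds for branching functions -/

section Spectrum

variable {E : Type*} [MetricSpace E]

theorem eventually_add_le_mul {ε δ K : ℝ} (h : ε < δ) : ∀ᶠ u : ℝ in atTop, ε * u + K ≤ δ * u := by
  filter_upwards [eventually_ge_atTop (K / (δ - ε))] with u hu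
  rw [div_le_iff₀ (sub_pos.2 h)] at hu
  linarith

theorem assouadSpectrum_le {θ d : ℝ} (hθ : θ < 1) (hd : 0 ≤ d)
    (H : ∀ ε > 0, ∃ K, ∀ᶠ u in atTop,
      branching E u (θ * u) ≤ ENNReal.ofReal (d * (u - θ * u) + ε * u + K)) :
    assouadSpectrum E θ ≤ ENNReal.ofReal d := by
  refine ENNReal.le_of_forall_pos_le_add fun δ hδ _ => ?_
  have hθ' : 0 < 1 - θ := sub_pos.2 hθ
  have hδ' : 0 < (δ : ℝ) * (1 - θ) := mul_pos (NNReal.coe_pos.2 hδ) hθ'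
  obtain ⟨K, hK⟩ := H _ (half_pos hδ')
  refine limsup_le_of_le (by isBoundedDefault) ?_
  filter_upwards [hK, eventually_add_le_mul (K := K) (half_lt_self hδ'), eventually_gt_atTop 0]
    with u hu hu1 hu0
  refine ENNReal.div_le_of_le_mul (hu.trans ?_)
  rw [← ENNReal.ofReal_coe_nnreal, ← ENNReal.ofReal_add hd δ.coe_nonneg,
    ← ENNReal.ofReal_mul (add_nonneg hd δ.coe_nonneg)]
  refine ENNReal.ofReal_le_ofReal ?_
  linarith

theorem le_assouadSpectrum {θ d : ℝ} (hθ : θ < 1)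
    (H : ∀ ε > 0, ∃ K, ∃ᶠ u in atTop,
      ENNReal.ofReal (d * (u - θ * u) - ε * u - K) ≤ branching E u (θ * u)) :
    ENNReal.ofReal d ≤ assouadSpectrum E θ := by
  refine ENNReal.le_of_forall_pos_le_add fun δ hδ _ => ?_
  have hθ' : 0 < 1 - θ := sub_pos.2 hθ
  have hδ' : 0 < (δ : ℝ) * (1 - θ) := mul_pos (NNReal.coe_pos.2 hδ) hθ'
  obtain ⟨K, hK⟩ := H _ (half_pos hδ')
  rw [← tsub_le_iff_right, ← ENNReal.ofReal_coe_nnreal, ← ENNReal.ofReal_sub _ δ.coe_nonneg]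
  refine le_limsup_of_frequently_le ?_ (by isBoundedDefault)
  refine (hK.and_eventually ((eventually_add_le_mul (K := K) (half_lt_self hδ')).and
    (eventually_gt_atTop 0))).mono fun u hu => ?_
  obtain ⟨h1, h2, h3⟩ := hu
  have h4 : 0 < u * (1 - θ) := mul_pos h3 hθ'
  rw [ENNReal.le_div_iff_mul_le (Or.inl (by simpa using h4)) (Or.inl ENNReal.ofReal_ne_top),
    ← ENNReal.ofReal_mul' h4.le]
  refine (ENNReal.ofReal_le_ofReal ?_).trans h1
  linarith

theorem exists_branching_le_of_upperAssouadSpectrum_le {θ d H : ℝ} (hθ : θ < 1) (hd : 0 ≤ d)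
    (hdH : d < H) (h : upperAssouadSpectrum E θ ≤ ENNReal.ofReal d) :
    ∃ U, 0 < U ∧ ∀ u v, U ≤ u → 0 ≤ v → v ≤ θ * u →
      branching E u v ≤ ENNReal.ofReal (H * (u - v)) := by
  have h1 := eventually_lt_of_limsup_lt (h.trans_lt
    ((ENNReal.ofReal_lt_ofReal_iff (hd.trans_lt hdH)).2 hdH))
  obtain ⟨U, hU⟩ := eventually_atTop.1 h1
  refine ⟨max U 1, by positivity, fun u v hu hv hvu => ?_⟩
  have hu0 : 0 < u := lt_of_lt_of_le one_pos ((le_max_right _ _).trans hu)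
  have hmem : v / u ∈ Icc 0 θ := ⟨div_nonneg hv hu0.le, (div_le_iff₀ hu0).2 hvu⟩
  have h2 := (le_iSup₂ (f := fun l (_ : l ∈ Icc (0 : ℝ) θ) =>
    branching E u (l * u) / ENNReal.ofReal (u * (1 - l))) (v / u) hmem).trans
    (hU u ((le_max_left _ _).trans hu)).le
  have h3 : u * (1 - v / u) = u - v := by
    rw [mul_sub, mul_one, mul_div_cancel₀ _ hu0.ne']
  have h4 : 0 < u - v := by nlinarith
  rw [div_mul_cancel₀ _ hu0.ne', h3, ENNReal.div_le_iff (by simpa using h4)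
    ENNReal.ofReal_ne_top, ← ENNReal.ofReal_mul (hd.trans hdH.le)] at h2
  exact h2

theorem exists_branching_ge_of_lt_upperAssouadSpectrum {θ d : ℝ} (hθ : θ < 1)
    (h : ENNReal.ofReal d < upperAssouadSpectrum E θ) :
    ∃ᶠ u in atTop, ∃ v, 0 ≤ v ∧ v ≤ θ * u ∧ ENNReal.ofReal (d * (u - v)) ≤ branching E u v := by
  refine ((frequently_lt_of_lt_limsup (by isBoundedDefault) h).and_eventually
    (eventually_gt_atTop 0)).mono fun u hu => ?_
  obtain ⟨h1, hu0⟩ := hu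
  obtain ⟨l, hl⟩ := lt_iSup_iff.1 h1
  obtain ⟨hl, h2⟩ := lt_iSup_iff.1 hl
  have h3 : 0 < u * (1 - l) := mul_pos hu0 (by linarith [hl.2])
  refine ⟨l * u, mul_nonneg hl.1 hu0.le, mul_le_mul_of_nonneg_right hl.2 hu0.le, ?_⟩
  have h4 := h2.le
  rw [ENNReal.le_div_iff_mul_le (Or.inl (by simpa using h3)) (Or.inl ENNReal.ofReal_ne_top),
    ← ENNReal.ofReal_mul' h3.le] at h4
  convert h4 using 2
  ring

end Spectrum

/-! ### Bounds from the quasi-Assouad dimension -/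

section QuasiAssouad

variable {X : Type*} [MetricSpace X] {α : ℝ}

theorem exists_coverNum_le_of_quasiAssouadDim (hα : 0 ≤ α)
    (hX : quasiAssouadDim X = ENNReal.ofReal α) {ε : ℝ} (hε : 0 < ε) :
    ∃ s θ K : ℝ, 0 ≤ s ∧ s < α + ε ∧ 0 < θ ∧ 1 - ε < θ ∧ θ < 1 ∧ 0 ≤ K ∧
      ∀ u v, 0 < v → v ≤ θ * u → ∀ x : X,
        (coverNum ((2 : ℝ) ^ (-u)) (Metric.ball x ((2 : ℝ) ^ (-v))) : ℝ≥0∞) ≤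
          twoPow (s * (u - v) + K) := by
  have h1 : quasiAssouadDim X < ENNReal.ofReal (α + ε) := by
    rw [hX]
    exact (ENNReal.ofReal_lt_ofReal_iff (by linarith)).2 (by linarith)
  have h2 := eventually_lt_of_limsup_lt h1
  have h3 : ∀ᶠ t : ℝ in 𝓝[<] 1, t ∈ Ioo (max 0 (1 - ε)) 1 :=
    Ioo_mem_nhdsLT (max_lt one_pos (by linarith))
  obtain ⟨θ, hθ, hθI⟩ := (h2.and h3).exists
  obtain ⟨s, hs⟩ := iInf_lt_iff.1 hθ
  obtain ⟨⟨C, hC, hcov⟩, hs⟩ := iInf_lt_iff.1 hs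
  rw [← ENNReal.ofReal_coe_nnreal, ENNReal.ofReal_lt_ofReal_iff (by linarith)] at hs
  have hθ0 : 0 < θ := (le_max_left _ _).trans_lt hθI.1
  refine ⟨s, θ, max (Real.logb 2 C) 0, s.2, hs, hθ0, (le_max_right _ _).trans_lt hθI.1, hθI.2,
    le_max_right _ _, fun u v hv hvu x => ?_⟩
  have hu : 0 < u := by
    by_contra! hu
    nlinarith
  have h4 : ((2 : ℝ) ^ (-u)) ^ θ = (2 : ℝ) ^ (-(θ * u)) := by
    rw [← Real.rpow_mul two_pos.le]
    congr 1
    ring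
  refine (hcov _ ((2 : ℝ) ^ (-v)) (two_rpow_neg_pos u) ?_ ?_ ?_ x).trans ?_
  · rw [h4]
    exact two_rpow_neg_le (by nlinarith [hθI.2])
  · rw [h4]
    exact two_rpow_neg_le hvu
  · exact Real.rpow_lt_one_of_one_lt_of_neg one_lt_two (by linarith)
  · have h5 : C * ((2 : ℝ) ^ (-v) / (2 : ℝ) ^ (-u)) ^ (s : ℝ) =
        (2 : ℝ) ^ (s * (u - v) + Real.logb 2 C) := by
      rw [← Real.rpow_sub two_pos, ← Real.rpow_mul two_pos.le, Real.rpow_add two_pos,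
        Real.rpow_logb two_pos (by norm_num) hC, mul_comm]
      congr 2
      ring
    rw [h5, ← twoPow_eq_ofReal]
    exact twoPow_mono (by linarith [le_max_left (Real.logb 2 C) 0])

variable [CompactSpace X]

/-- Balls of radius comparable to `2 ^ (-u)` are covered by `2 ^ o(u)` balls of radius
`2 ^ (-(u + 1))`. -/
theorem exists_coverNum_ball_le (hα : 0 ≤ α) (hX : quasiAssouadDim X = ENNReal.ofReal α) (c : ℝ)
    {ε : ℝ} (hε : 0 < ε) : ∃ K, 0 ≤ K ∧ ∀ u, 0 ≤ u → ∀ x : X,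
      (coverNum ((2 : ℝ) ^ (-(u + 1))) (Metric.ball x ((2 : ℝ) ^ (-(u - c)))) : ℝ≥0∞) ≤
        twoPow (ε * u + K) := by
  set δ := min 1 (ε / (α + 1)) with hδ
  have hδ0 : 0 < δ := by positivity
  obtain ⟨s, θ, K, hs0, hs, hθ0, hθδ, hθ1, hK, H⟩ :=
    exists_coverNum_le_of_quasiAssouadDim hα hX hδ0
  have hsε : s * (1 - θ) ≤ ε := by
    have h1 : s ≤ α + 1 := hs.le.trans (by linarith [min_le_left 1 (ε / (α + 1))])
    have h2 : 1 - θ ≤ ε / (α + 1) := (by linarith : 1 - θ ≤ δ).trans (min_le_right _ _)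
    calc s * (1 - θ) ≤ (α + 1) * (ε / (α + 1)) := by
          apply mul_le_mul h1 h2 (by linarith) (by linarith)
      _ = ε := mul_div_cancel₀ _ (by linarith)
  set U := max 0 ((c + θ) / (1 - θ)) with hU
  obtain ⟨K', hK', hcov⟩ := exists_le_twoPow
    (coverNum_ne_top (two_rpow_neg_pos (U + 1)) (univ : Set X))
  refine ⟨max (ε + K) K', le_max_of_le_right hK', fun u hu x => ?_⟩
  rcases le_total U u with h1 | h1
  · have h2 := (le_max_right _ _).trans h1
    rw [div_le_iff₀ (sub_pos.2 hθ1)] at h2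
    have h3 := H (u + 1) (θ * (u + 1)) (by positivity) le_rfl x
    refine le_trans (ENat.toENNReal_le.2 (coverNum_mono (Metric.ball_subset_ball
      (two_rpow_neg_le (by linarith))))) (h3.trans (twoPow_mono ?_))
    have h4 : s * (1 - θ) * (u + 1) ≤ ε * (u + 1) := by gcongr
    linarith [le_max_left (ε + K) K']
  · refine le_trans (ENat.toENNReal_le.2 ((coverNum_mono (subset_univ _)).trans
      (coverNum_anti (two_rpow_neg_le (u' := U + 1) (by linarith)) _)))
      (hcov.trans (twoPow_mono ?_))
    have : 0 ≤ ε * u := by positivity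
    linarith [le_max_right (ε + K) K']

theorem exists_coverNum_univ_le (hα : 0 ≤ α) (hX : quasiAssouadDim X = ENNReal.ofReal α)
    {ε : ℝ} (hε : 0 < ε) : ∃ K, 0 ≤ K ∧ ∀ u, 0 ≤ u →
      (coverNum ((2 : ℝ) ^ (-u)) (univ : Set X) : ℝ≥0∞) ≤ twoPow ((α + ε) * u + K) := by
  obtain ⟨s, θ, K, hs0, hs, hθ0, -, hθ1, hK, H⟩ := exists_coverNum_le_of_quasiAssouadDim hα hX hε
  obtain ⟨K₁, hK₁, h₁⟩ := exists_le_twoPow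
    (coverNum_ne_top (two_rpow_neg_pos 1) (univ : Set X))
  obtain ⟨K₂, hK₂, h₂⟩ := exists_le_twoPow
    (coverNum_ne_top (two_rpow_neg_pos (1 / θ)) (univ : Set X))
  refine ⟨max (K + K₁) K₂, le_max_of_le_right hK₂, fun u hu => ?_⟩
  have hαu : 0 ≤ (α + ε) * u := by positivity
  rcases le_total (1 / θ) u with hu1 | hu1
  · rw [div_le_iff₀' hθ0] at hu1
    refine (coverNum_le_mul (two_rpow_neg_pos u) (two_rpow_neg_pos 1)
      (c := twoPow (s * (u - 1) + K)) fun x => ?_).trans ?_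
    · rw [univ_inter]
      exact H u 1 one_pos hu1 x
    · calc _ ≤ twoPow K₁ * twoPow (s * (u - 1) + K) := by gcongr
        _ = twoPow (K₁ + (s * (u - 1) + K)) := (twoPow_add _ _).symm
        _ ≤ _ := by
          refine twoPow_mono ?_
          have : s * u ≤ (α + ε) * u := by gcongr
          linarith [le_max_left (K + K₁) K₂]
  · exact (ENat.toENNReal_le.2 (coverNum_anti (two_rpow_neg_le hu1) _)).trans
      (h₂.trans (twoPow_mono (by linarith [le_max_right (K + K₁) K₂])))

end QuasiAssouad

/-! ### The structure of the attractor -/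

theorem IsInhomAttractor.image_wordMap_subset {X ι : Type*} [MetricSpace X]
    {f : ι → X → X} {F Λ : Set X} (hΛ : IsInhomAttractor f F Λ) (w : List ι) :
    wordMap f w '' Λ ⊆ Λ := by
  induction w with
  | nil => simp [wordMap]
  | cons i w ih =>
    rw [wordMap, image_comp]
    refine (image_mono ih).trans ?_
    conv_rhs => rw [hΛ.invariant]
    exact (subset_iUnion (fun i => f i '' Λ) i).trans subset_union_right

theorem IsInhomAttractor.subset {X ι : Type*} [MetricSpace X] {f : ι → X → X} {F Λ : Set X}
    (hΛ : IsInhomAttractor f F Λ) : F ⊆ Λ := by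
  conv_rhs => rw [hΛ.invariant]
  exact subset_union_left

namespace WordWeight

variable {X ι : Type*} [MetricSpace X] {f : ι → X → X} {ρ : List ι → ℝ} {a b A h α : ℝ}

/-- The critical exponent is at most the quasi-Assouad dimension of the ambient space. -/
theorem critical_exponent_le [CompactSpace X] [Nonempty X] [Finite ι] [Nonempty ι]
    (hρ : WordWeight ρ a b A) (h0 : 0 ≤ h)
    (hh : Tendsto (fun u : ℝ => Real.logb 2 ((cutWords ρ u).ncard : ℝ) / u) atTop (𝓝 h))
    (hb : AsymptoticallyBounded f ρ) (hα : 0 ≤ α) (hX : quasiAssouadDim X = ENNReal.ofReal α) :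
    h ≤ α := by
  refine le_of_forall_pos_le_add fun δ hδ => ?_
  have hε : 0 < δ / 4 := by linarith
  obtain ⟨K₁, hK₁, h₁⟩ := hρ.exists_twoPow_le_ncard h0 hh hε
  obtain ⟨K₂, hK₂, h₂⟩ := exists_coverNum_univ_le hα hX hε
  obtain ⟨K₃, hK₃, h₃⟩ := hρ.exists_encard_cutWordsNear_le hb hε
  have key : ∀ u, 0 ≤ u → (h - δ / 4) * u - K₁ ≤ (α + δ / 4) * u + K₂ + (δ / 4 * u + K₃) := by
    intro u hu
    obtain ⟨C, hC, hCe⟩ := exists_cover (two_rpow_neg_pos u) (univ : Set X)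
    have hcover : cutWords ρ u ⊆ ⋃ x ∈ C, cutWordsNear f ρ x u := fun w hw => by
      obtain ⟨x, hx, hxy⟩ := mem_iUnion₂.1 (hC (mem_univ (wordMap f w (Classical.arbitrary X))))
      exact mem_biUnion hx ⟨hw, _, mem_range_self _, hxy⟩
    rw [← twoPow_strictMono.le_iff_le]
    calc twoPow ((h - δ / 4) * u - K₁) ≤ (cutWords ρ u).ncard := h₁ u hu
      _ = ((cutWords ρ u).encard : ℝ≥0∞) := by
        rw [← (hρ.finite_cutWords u).cast_ncard_eq, ENat.toENNReal_coe]
      _ = ∑' _ : cutWords ρ u, (1 : ℝ≥0∞) := (ENNReal.tsum_set_one _).symm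
      _ ≤ ∑' _ : ⋃ x ∈ C, cutWordsNear f ρ x u, (1 : ℝ≥0∞) :=
        ENNReal.tsum_mono_subtype (fun _ => 1) hcover
      _ ≤ ∑' x : C, ∑' _ : cutWordsNear f ρ x.1 u, (1 : ℝ≥0∞) :=
        ENNReal.tsum_biUnion_le_tsum (fun _ => 1) C (fun x => cutWordsNear f ρ x u)
      _ ≤ ∑' _ : C, twoPow (δ / 4 * u + K₃) := ENNReal.tsum_le_tsum fun x => by
        rw [ENNReal.tsum_set_one]
        have := h₃ x u
        rwa [max_eq_left hu] at this
      _ = C.encard * twoPow (δ / 4 * u + K₃) := ENNReal.tsum_set_const _ _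
      _ ≤ twoPow ((α + δ / 4) * u + K₂) * twoPow (δ / 4 * u + K₃) := by
        rw [hCe]
        gcongr
        exact h₂ u hu
      _ = _ := (twoPow_add _ _).symm
  by_contra! hlt
  obtain ⟨u, hu, hu0⟩ := ((eventually_gt_atTop (4 * (K₁ + K₂ + K₃) / δ)).and
    (eventually_gt_atTop 0)).exists
  rw [div_lt_iff₀ hδ] at hu
  have := key u hu0.le
  nlinarith

/-- The attractor is exhausted by the copies `f_w(F)` of weight less than `t` and the cylinders cut
off at weight `t`. -/
theorem attractor_subset (hρ : WordWeight ρ a b A) {F Λ : Set X} (hΛ : IsInhomAttractor f F Λ)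
    (t : ℝ) : Λ ⊆ (⋃ w ∈ {w | ρ w < t}, wordMap f w '' F) ∪
      ⋃ w ∈ cutWords ρ t, wordMap f w '' Λ := by
  suffices H : ∀ n : ℕ, ∀ w : List ι, t - ρ w ≤ n * a → (w ≠ [] → ρ w.dropLast < t) →
      wordMap f w '' Λ ⊆ (⋃ w ∈ {w | ρ w < t}, wordMap f w '' F) ∪
        ⋃ w ∈ cutWords ρ t, wordMap f w '' Λ by
    obtain ⟨n, hn⟩ := exists_nat_ge ((t - ρ []) / a)
    rw [div_le_iff₀ hρ.a_pos] at hn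
    simpa [wordMap] using H n [] hn (fun h => absurd rfl h)
  intro n
  induction n with
  | zero =>
    intro w hw hw'
    have : w ∈ cutWords ρ t := ⟨by simp at hw; linarith, hw'⟩
    exact (subset_biUnion_of_mem (u := fun w => wordMap f w '' Λ) this).trans subset_union_right
  | succ n ih =>
    intro w hw hw'
    rcases le_or_gt t (ρ w) with h1 | h1
    · have : w ∈ cutWords ρ t := ⟨h1, hw'⟩
      exact (subset_biUnion_of_mem (u := fun w => wordMap f w '' Λ) this).trans subset_union_right
    · rw [hΛ.invariant, image_union, image_iUnion]
      rw [← hΛ.invariant]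
      refine union_subset ?_ (iUnion_subset fun i => ?_)
      · have : w ∈ {w | ρ w < t} := h1
        exact (subset_biUnion_of_mem (u := fun w => wordMap f w '' F) this).trans subset_union_left
      · have h2 : wordMap f w '' (f i '' Λ) = wordMap f (w ++ [i]) '' Λ := by
          rw [wordMap_append, image_comp]
          rfl
        rw [h2]
        refine ih _ ?_ (fun _ => by simpa using h1)
        have h3 := hρ.superadd w [i]
        have h4 := hρ.le_letter i
        push_cast at hw
        linarith

end WordWeight

theorem MinimallyDistorting.exists_coverNum_range_le {X ι : Type*} [MetricSpace X] [CompactSpace X]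
    {f : ι → X → X} {F : Set X} {ρ : List ι → ℝ} {α : ℝ} (hf : MinimallyDistorting f F ρ)
    (hα : 0 ≤ α) (hX : quasiAssouadDim X = ENNReal.ofReal α) {ε : ℝ} (hε : 0 < ε) :
    ∃ K, 0 ≤ K ∧ ∀ w u, 0 ≤ u → u ≤ ρ w →
      (coverNum ((2 : ℝ) ^ (-(u + 1))) (range (wordMap f w)) : ℝ≥0∞) ≤ twoPow (ε * u + K) := by
  obtain ⟨C, hC⟩ := hf.diam_le
  set c := Real.logb 2 (|C| + 1) with hc
  have hc2 : (2 : ℝ) ^ c = |C| + 1 := Real.rpow_logb two_pos (by norm_num) (by positivity)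
  obtain ⟨K, hK, H⟩ := exists_coverNum_ball_le hα hX c hε
  refine ⟨K, hK, fun w u hu huw => ?_⟩
  rcases isEmpty_or_nonempty X with hX | ⟨⟨x⟩⟩
  · rw [range_eq_empty, coverNum_empty]
    simp
  · refine (ENat.toENNReal_le.2 (coverNum_mono ?_)).trans (H u hu (wordMap f w x))
    rintro _ ⟨y, rfl⟩
    rw [Metric.mem_ball, neg_sub, sub_eq_add_neg, Real.rpow_add two_pos, hc2]
    calc dist (wordMap f w y) (wordMap f w x) ≤ C * (2 : ℝ) ^ (-ρ w) := hC w y x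
      _ ≤ |C| * (2 : ℝ) ^ (-u) := by
        refine mul_le_mul (le_abs_self _) (two_rpow_neg_le huw) (two_rpow_neg_pos _).le
          (abs_nonneg _)
      _ < (|C| + 1) * (2 : ℝ) ^ (-u) := by
        have := two_rpow_neg_pos u
        linarith

/-! ### The upper bound for the spectrum of the attractor -/

section Upper

variable {X ι : Type*} [MetricSpace X] {f : ι → X → X} {F : Set X} {ρ : List ι → ℝ} {η : ℝ → ℝ}

/-- The condition that the copies `f_w(F)` have uniformly the same branching function as `F`, up to
the error `η`. -/
def UniformCopies (f : ι → X → X) (F : Set X) (ρ : List ι → ℝ) (η : ℝ → ℝ) : Prop :=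
  ∀ (w : List ι) (u v : ℝ), 0 ≤ v → v ≤ u →
    branching (wordMap f w '' F) (u + ρ w) (v + ρ w) ≤
      branching F u v + ENNReal.ofReal (η (u + ρ w)) ∧
    branching F u v ≤
      branching (wordMap f w '' F) (u + ρ w) (v + ρ w) + ENNReal.ofReal (η (u + ρ w))

theorem UniformCopies.coverNum_le (hu : UniformCopies f F ρ η) {w : List ι} {T s t : ℝ}
    (hη : 0 ≤ η T) (hs : ρ w ≤ s) (hsT : s ≤ T) (ht : 0 ≤ t)
    (h : branching F (T - ρ w) (s - ρ w) ≤ ENNReal.ofReal t) {S : Set X} {y : X}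
    (hS : S ⊆ wordMap f w '' F) (hSy : S ⊆ Metric.ball y ((2 : ℝ) ^ (-(s + 1)))) :
    (coverNum ((2 : ℝ) ^ (-T)) S : ℝ≥0∞) ≤ twoPow (t + η T) := by
  rcases S.eq_empty_or_nonempty with rfl | ⟨z, hz⟩
  · rw [coverNum_empty]
    simp
  have h1 := (hu w (T - ρ w) (s - ρ w) (by linarith) (by linarith)).1
  rw [sub_add_cancel, sub_add_cancel] at h1
  have h2 := h1.trans (add_le_add_left h _)
  rw [← ENNReal.ofReal_add ht hη] at h2
  refine coverNum_le_twoPow_of_branching (add_nonneg ht hη) h2 (hS hz) hS fun p hp => ?_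
  have h3 := hSy hz
  have h4 := hSy hp
  rw [Metric.mem_ball] at *
  rw [← two_mul_two_rpow_neg s]
  have := dist_triangle_right p z y
  linarith

variable {a b A h θ d α : ℝ} {Λ : Set X}

/-- If the spectrum of `F` up to the angle `θ` is at most `d`, and `d` is at least the critical
exponent, then `β_Λ(u, θ u) ≤ d (1 - θ) u + o(u)`. A ball `B(x, 2 ^ (-θ u))` is covered by three
families of pieces of `Λ`: large copies of `F`, which are few and see the ball at an angle at most
`θ`; small copies of `F`; and cylinders of size `2 ^ (-u)`. The last two families together are
controlled by the Poincaré series at an exponent just above `d`. -/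
theorem branching_attractor_le [CompactSpace X] [Finite ι] [Nonempty ι]
    (hρ : WordWeight ρ a b A) (hf : MinimallyDistorting f F ρ) (hb : AsymptoticallyBounded f ρ)
    (hα : 0 ≤ α) (hX : quasiAssouadDim X = ENNReal.ofReal α) (hΛ : IsInhomAttractor f F Λ)
    (h0 : 0 ≤ h)
    (hh : Tendsto (fun u : ℝ => Real.logb 2 ((cutWords ρ u).ncard : ℝ) / u) atTop (𝓝 h))
    (hθ : θ ∈ Ico (0 : ℝ) 1) (hhd : h ≤ d)
    (hF : upperAssouadSpectrum F θ ≤ ENNReal.ofReal d) {ε : ℝ} (hε : 0 < ε) :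
    ∃ K, ∀ᶠ u in atTop,
      branching Λ u (θ * u) ≤ ENNReal.ofReal (d * (u - θ * u) + 4 * ε * u + K) := by
  have hd := h0.trans hhd
  set H := d + ε with hH
  have hH0 : 0 ≤ H := by positivity
  have hb0 := hρ.b_nonneg
  obtain ⟨U, hU, hFU⟩ := exists_branching_le_of_upperAssouadSpectrum_le hθ.2 hd
    (lt_add_of_pos_right d hε) hF
  have hF0 : ∀ u, 0 ≤ u → branching F u 0 ≤ ENNReal.ofReal (H * u + H * U) := fun u hu => by
    have hmax : U ≤ max u U := le_max_right _ _
    have h1 := hFU (max u U) 0 hmax le_rfl (mul_nonneg hθ.1 (hU.le.trans hmax))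
    refine (branching_mono_left (le_max_left u U) 0).trans (h1.trans (ENNReal.ofReal_le_ofReal ?_))
    rw [sub_zero, ← mul_add]
    exact mul_le_mul_of_nonneg_left (max_le (by linarith) (by linarith)) hH0
  obtain ⟨η, hη, huni⟩ := hf.uniform
  replace huni : UniformCopies f F ρ η := huni
  obtain ⟨K₂, hK₂, hηK⟩ := hη.exists_le hε
  obtain ⟨K₃, hK₃, hP⟩ := exists_le_twoPow
    (hρ.tsum_twoPow_ne_top h0 hh (H := H) (by linarith))
  obtain ⟨K₄, hK₄, hnear⟩ := hρ.exists_encard_cutWordsNear_le hb hε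
  obtain ⟨K₅, hK₅, hlarge⟩ := hρ.exists_encard_large_le hb hε
  obtain ⟨K₆, hK₆, hcyl⟩ := hf.exists_coverNum_range_le hα hX hε
  set K₇ := K₆ + H * U + K₂ + H * b with hK₇
  set K := 2 * H + 2 * ε + K₇ + K₄ + K₃ + K₅ + 2 with hK
  refine ⟨K, ?_⟩
  filter_upwards [eventually_ge_atTop (U / (1 - θ)), eventually_ge_atTop 0] with u hu1 hu0
  rw [div_le_iff₀ (sub_pos.2 hθ.2)] at hu1
  refine branching_le_of_coverNum fun x _ => ?_
  set v := θ * u with hv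
  have hv0 : 0 ≤ v := mul_nonneg hθ.1 hu0
  have hvu : v ≤ u := by nlinarith [hθ.2]
  set T := u + 1 with hT
  have hT0 : 0 ≤ T := by linarith
  have hηT := hηK T hT0
  have hηT0 := hη.nonneg T hT0
  set B := Metric.ball x ((2 : ℝ) ^ (-v)) with hB
  have hBB : B ⊆ Metric.ball x ((2 : ℝ) ^ (-(v - 1))) :=
    Metric.ball_subset_ball (two_rpow_neg_le (by linarith))
  set G := d * (u - v) + 4 * ε * u + K - 2 with hG
  have hduv : H * (u - v) ≤ d * (u - v) + ε * u := by nlinarith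
  -- the three families of words
  set W₁ := {w | ρ w ≤ v - 1 ∧
    (range (wordMap f w) ∩ Metric.ball x ((2 : ℝ) ^ (-(v - 1)))).Nonempty} with hW₁
  set W₂ := {w | v - 1 ≤ ρ w ∧
    (range (wordMap f w) ∩ Metric.ball x ((2 : ℝ) ^ (-(v - 1)))).Nonempty} with hW₂
  set S₁ := ⋃ w : W₁, (wordMap f w '' F ∩ B) with hS₁
  set S₂ := ⋃ w : W₂, {y ∈ wordMap f w '' F | ρ w < T} with hS₂
  set S₃ := ⋃ w : W₂, {y ∈ wordMap f w '' Λ | w.1 ∈ cutWords ρ T} with hS₃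
  have hmeets : ∀ {w : List ι} {y : X} {E : Set X}, y ∈ wordMap f w '' E → y ∈ B →
      (range (wordMap f w) ∩ Metric.ball x ((2 : ℝ) ^ (-(v - 1)))).Nonempty :=
    fun {w y E} hy hyB => ⟨y, image_subset_range _ _ hy, hBB hyB⟩
  have hcover : B ∩ Λ ⊆ S₁ ∪ (S₂ ∪ S₃) := by
    rintro y ⟨hyB, hyΛ⟩
    rcases hρ.attractor_subset hΛ T hyΛ with h1 | h1
    · obtain ⟨w, hw, hy⟩ := mem_iUnion₂.1 h1
      rcases le_total (ρ w) (v - 1) with h2 | h2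
      · exact Or.inl (mem_iUnion.2 ⟨⟨w, h2, hmeets hy hyB⟩, hy, hyB⟩)
      · exact Or.inr (Or.inl (mem_iUnion.2 ⟨⟨w, h2, hmeets hy hyB⟩, hy, hw⟩))
    · obtain ⟨w, hw, hy⟩ := mem_iUnion₂.1 h1
      have h2 : v - 1 ≤ ρ w := by linarith [hw.1]
      exact Or.inr (Or.inr (mem_iUnion.2 ⟨⟨w, h2, hmeets hy hyB⟩, hy, hw⟩))
  have hr := two_rpow_neg_pos T
  -- large copies: their number is subexponential and each sees `B` at an angle at most `θ`
  have cost₁ : (coverNum ((2 : ℝ) ^ (-T)) S₁ : ℝ≥0∞) ≤ twoPow G := by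
    have hterm : ∀ w : W₁, (coverNum ((2 : ℝ) ^ (-T)) (wordMap f w '' F ∩ B) : ℝ≥0∞) ≤
        twoPow (H * (u - v + 2) + η T) := fun w => by
      have hw := w.2.1
      have hw0 := hρ.nonneg w.1
      refine huni.coverNum_le (s := v - 1) hηT0 hw (by linarith)
        (mul_nonneg hH0 (by linarith)) ?_ inter_subset_left (y := x) ?_
      · have h1 := hFU (T - ρ w) (v - 1 - ρ w) (by linarith) (by linarith)
          (by nlinarith [hθ.1, hθ.2])
        convert h1 using 3
        ring
      · rw [sub_add_cancel]
        exact inter_subset_right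
    have hcard : (W₁.encard : ℝ≥0∞) ≤ twoPow (ε * u + K₅) := by
      rcases le_or_gt 0 (v - 1) with h1 | h1
      · refine (hlarge x (v - 1) h1).trans (twoPow_mono ?_)
        gcongr
        linarith
      · have : W₁ = ∅ := eq_empty_of_forall_notMem fun w hw => by
          linarith [hρ.nonneg w, hw.1]
        rw [this]
        simp
    calc _ ≤ ∑' w : W₁, (coverNum ((2 : ℝ) ^ (-T)) (wordMap f w '' F ∩ B) : ℝ≥0∞) :=
          coverNum_iUnion_le hr _
      _ ≤ ∑' _ : W₁, twoPow (H * (u - v + 2) + η T) := ENNReal.tsum_le_tsum hterm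
      _ = W₁.encard * twoPow (H * (u - v + 2) + η T) := ENNReal.tsum_set_const _ _
      _ ≤ twoPow (ε * u + K₅) * twoPow (H * (u - v + 2) + η T) := by gcongr
      _ = twoPow (ε * u + K₅ + (H * (u - v + 2) + η T)) := (twoPow_add _ _).symm
      _ ≤ twoPow G := twoPow_mono (by
        have : 0 ≤ H * U + H * b := by positivity
        have : 0 ≤ ε * u := by positivity
        linarith)
  -- the remaining pieces are weighted by the Poincaré series
  have poincare : ∀ S : W₂ → Set X,
      (∀ w : W₂, (coverNum ((2 : ℝ) ^ (-T)) (S w) : ℝ≥0∞) ≤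
        twoPow (H * T + 2 * ε * T + K₇) * twoPow (-(H * ρ w))) →
      (coverNum ((2 : ℝ) ^ (-T)) (⋃ w, S w) : ℝ≥0∞) ≤ twoPow G := fun S hS => by
    calc _ ≤ ∑' w : W₂, (coverNum ((2 : ℝ) ^ (-T)) (S w) : ℝ≥0∞) := coverNum_iUnion_le hr _
      _ ≤ ∑' w : W₂, twoPow (H * T + 2 * ε * T + K₇) * twoPow (-(H * ρ w)) :=
        ENNReal.tsum_le_tsum hS
      _ = twoPow (H * T + 2 * ε * T + K₇) * ∑' w : W₂, twoPow (-(H * ρ w)) :=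
        ENNReal.tsum_mul_left
      _ ≤ twoPow (H * T + 2 * ε * T + K₇) *
          (twoPow (ε * max (v - 1) 0 + K₄) * (twoPow (-(H * (v - 1))) * twoPow K₃)) := by
        gcongr
        refine (hρ.tsum_near_le hH0 x (v - 1)).trans ?_
        gcongr
        exact hnear x (v - 1)
      _ = twoPow (H * T + 2 * ε * T + K₇ +
          (ε * max (v - 1) 0 + K₄ + (-(H * (v - 1)) + K₃))) := by
        rw [twoPow_add _ (ε * max (v - 1) 0 + K₄ + (-(H * (v - 1)) + K₃)),
          twoPow_add (ε * max (v - 1) 0 + K₄), twoPow_add (-(H * (v - 1)))]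
      _ ≤ twoPow G := twoPow_mono (by
        have : ε * max (v - 1) 0 ≤ ε * u := by
          gcongr
          exact max_le (by linarith) hu0
        linarith)
  have cost₂ : (coverNum ((2 : ℝ) ^ (-T)) S₂ : ℝ≥0∞) ≤ twoPow G := poincare _ fun w => by
    by_cases hw : ρ w < T
    · have hw0 := hρ.nonneg w.1
      calc _ ≤ (coverNum ((2 : ℝ) ^ (-T)) (wordMap f w '' F) : ℝ≥0∞) :=
            ENat.toENNReal_le.2 (coverNum_mono fun y hy => hy.1)
        _ ≤ coverNum ((2 : ℝ) ^ (-(ρ w + 1))) (wordMap f w '' F) *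
            twoPow (H * (T - ρ w) + H * U + η T) :=
          coverNum_le_mul hr (two_rpow_neg_pos _) fun z =>
            huni.coverNum_le (s := ρ w) hηT0 le_rfl hw.le
              (add_nonneg (mul_nonneg hH0 (by linarith)) (by positivity))
              (by rw [sub_self]; exact hF0 _ (by linarith)) inter_subset_left inter_subset_right
        _ ≤ twoPow (ε * ρ w + K₆) * twoPow (H * (T - ρ w) + H * U + η T) := by
          gcongr
          exact (ENat.toENNReal_le.2 (coverNum_mono (image_subset_range _ _))).trans
            (hcyl w _ hw0 le_rfl)
        _ ≤ twoPow (H * T + 2 * ε * T + K₇) * twoPow (-(H * ρ w)) := by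
          rw [← twoPow_add, ← twoPow_add]
          refine twoPow_mono ?_
          have h1 : ε * ρ w ≤ ε * T := by gcongr
          have h2 : 0 ≤ H * b := by positivity
          linarith
    · have : {y ∈ wordMap f w '' F | ρ w < T} = ∅ :=
        eq_empty_of_forall_notMem fun y hy => hw hy.2
      rw [this, coverNum_empty]
      simp
  have cost₃ : (coverNum ((2 : ℝ) ^ (-T)) S₃ : ℝ≥0∞) ≤ twoPow G := poincare _ fun w => by
    by_cases hw : w.1 ∈ cutWords ρ T
    · calc _ ≤ (coverNum ((2 : ℝ) ^ (-T)) (range (wordMap f w)) : ℝ≥0∞) :=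
            ENat.toENNReal_le.2 (coverNum_mono fun y hy => image_subset_range _ _ hy.1)
        _ ≤ twoPow (ε * u + K₆) := hcyl w u hu0 (by linarith [hw.1])
        _ ≤ twoPow (H * T + 2 * ε * T + K₇) * twoPow (-(H * ρ w)) := by
          rw [← twoPow_add]
          refine twoPow_mono ?_
          have h1 := hρ.le_of_mem_cutWords hw
          rw [max_eq_left hT0] at h1
          have h2 : H * ρ w ≤ H * (T + b) := by gcongr
          have h3 : 0 ≤ H * U := by positivity
          have h4 : 0 ≤ ε * u := by positivity
          linarith
    · have : {y ∈ wordMap f w '' Λ | w.1 ∈ cutWords ρ T} = ∅ :=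
        eq_empty_of_forall_notMem fun y hy => hw hy.2
      rw [this, coverNum_empty]
      simp
  have h1 : coverNum ((2 : ℝ) ^ (-T)) (B ∩ Λ) ≤ coverNum ((2 : ℝ) ^ (-T)) S₁ +
      (coverNum ((2 : ℝ) ^ (-T)) S₂ + coverNum ((2 : ℝ) ^ (-T)) S₃) :=
    (coverNum_mono hcover).trans ((coverNum_union_le hr _ _).trans
      (add_le_add_right (coverNum_union_le hr _ _) _))
  have h2 := ENat.toENNReal_le.2 h1
  rw [ENat.toENNReal_add, ENat.toENNReal_add] at h2
  calc _ ≤ _ := h2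
    _ ≤ twoPow G + (twoPow G + twoPow G) := by gcongr
    _ ≤ 4 * twoPow G := by
      rw [show (4 : ℝ≥0∞) = 1 + (1 + (1 + 1)) by norm_num, add_mul, add_mul, add_mul, one_mul]
      gcongr
      exact le_self_add
    _ = twoPow (2 + G) := by
      rw [twoPow_add, twoPow_two]
    _ = _ := by rw [hG]; congr 1; ring

end Upper

/-! ### The lower bounds for the spectrum of the attractor -/

section Lower

variable {X ι : Type*} [MetricSpace X] {f : ι → X → X} {F Λ : Set X} {ρ : List ι → ℝ}
  {a b A h θ d : ℝ}

/-- Copies of `F` inside `Λ` realize at the angle `θ` the scale pairs `(u, v)` of `F` with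
`v ≤ θ u`: under a map `f_w` with `ρ w ≈ (θ u - v) / (1 - θ)` the pair is translated to a pair at
the angle `θ`. -/
theorem upperAssouadSpectrum_le_assouadSpectrum [Nonempty ι]
    (hρ : WordWeight ρ a b A) (hf : MinimallyDistorting f F ρ) (hΛ : IsInhomAttractor f F Λ)
    (hθ : θ ∈ Ico (0 : ℝ) 1) : upperAssouadSpectrum F θ ≤ assouadSpectrum Λ θ := by
  refine ENNReal.le_of_forall_nnreal_lt fun d hd => ?_
  rw [← ENNReal.ofReal_coe_nnreal] at hd ⊢
  have hfreq := exists_branching_ge_of_lt_upperAssouadSpectrum hθ.2 hd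
  have hd0 := d.coe_nonneg
  have hb0 := hρ.b_nonneg
  have hθ1 := sub_pos.2 hθ.2
  obtain ⟨η, hη, huni⟩ := hf.uniform
  refine le_assouadSpectrum hθ.2 fun ε hε => ?_
  obtain ⟨K, hK, hηK⟩ := hη.exists_le hε
  refine ⟨K + d * (b + 2), frequently_atTop.2 fun a₀ => ?_⟩
  obtain ⟨u, hu, v, hv0, hvθ, huv⟩ := frequently_atTop.1 hfreq (max a₀ 0)
  have hu0 : 0 ≤ u := (le_max_right _ _).trans hu
  have hua : a₀ ≤ u := (le_max_left _ _).trans hu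
  have hvu : v ≤ u := by nlinarith [hθ.2]
  -- the summand `θ` makes up for the unit of scale lost when `f_w(F)` is regarded as a subset
  set z := (θ * u - v + θ) / (1 - θ) with hz
  have hz0 : 0 ≤ z := div_nonneg (by linarith [hθ.1]) hθ1.le
  have hz1 : z * (1 - θ) = θ * u - v + θ := div_mul_cancel₀ _ hθ1.ne'
  obtain ⟨w, hw⟩ := hρ.cutWords_nonempty z
  have hw1 := hw.1
  have hw2 := hρ.le_of_mem_cutWords hw
  rw [max_eq_left hz0] at hw2
  refine ⟨u + ρ w + 1, by linarith, ?_⟩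
  have hsub : wordMap f w '' F ⊆ Λ :=
    (image_mono hΛ.subset).trans (hΛ.image_wordMap_subset w)
  have hangle : θ * (u + ρ w + 1) ≤ v + ρ w := by nlinarith
  have h1 : branching F u v ≤ branching Λ (u + ρ w + 1) (θ * (u + ρ w + 1)) +
      ENNReal.ofReal (η (u + ρ w)) :=
    (huni w u v hv0 hvu).2.trans (add_le_add_left ((branching_le_of_subset hsub _ _).trans
      (branching_anti_right _ hangle)) _)
  have h2 := huv.trans h1
  rw [← tsub_le_iff_right, ← ENNReal.ofReal_sub _ (hη.nonneg _ (by linarith))] at h2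
  refine (ENNReal.ofReal_le_ofReal ?_).trans h2
  have h3 := hηK (u + ρ w) (by linarith)
  have h4 : (u + ρ w + 1) - θ * (u + ρ w + 1) ≤ u - v + (b + 2) := by
    have : ρ w * (1 - θ) ≤ (z + b) * (1 - θ) := by gcongr
    nlinarith [hθ.1]
  have h5 := mul_le_mul_of_nonneg_left h4 hd0
  linarith

/-- A cylinder of size `2 ^ (-θ u)` contains about `2 ^ (h (1 - θ) u)` cylinders of size
`2 ^ (-u)`, and only `2 ^ o(u)` of these meet a given ball of radius `2 ^ (-u)`. -/
theorem critical_exponent_le_assouadSpectrum [Finite ι] [Nonempty ι]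
    (hρ : WordWeight ρ a b A) (hf : MinimallyDistorting f F ρ) (hb : AsymptoticallyBounded f ρ)
    (hΛ : IsInhomAttractor f F Λ) (h0 : 0 ≤ h)
    (hh : Tendsto (fun u : ℝ => Real.logb 2 ((cutWords ρ u).ncard : ℝ) / u) atTop (𝓝 h))
    (hθ : θ ∈ Ico (0 : ℝ) 1) : ENNReal.ofReal h ≤ assouadSpectrum Λ θ := by
  refine le_assouadSpectrum hθ.2 fun ε hε => ?_
  obtain ⟨C, hC⟩ := hf.diam_le
  obtain ⟨y₀, hy₀⟩ := hΛ.nonempty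
  set c := Real.logb 2 (|C| + 1) with hc
  have hc2 : (2 : ℝ) ^ c = |C| + 1 := Real.rpow_logb two_pos (by norm_num) (by positivity)
  have hc0 : 0 ≤ c := Real.logb_nonneg one_lt_two (by linarith [abs_nonneg C])
  obtain ⟨K₁, hK₁, hN⟩ := hρ.exists_twoPow_le_ncard h0 hh (half_pos hε)
  obtain ⟨K₂, hK₂, hnear⟩ := hρ.exists_encard_cutWordsNear_le hb (half_pos hε)
  set L := c + 2 * b + A with hL
  have hshort : ({w | ρ w ≤ L}.encard : ℝ≥0∞) ≠ ⊤ := by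
    rw [← (hρ.finite_le L).cast_ncard_eq, ENat.toENNReal_coe]
    exact ENNReal.natCast_ne_top _
  obtain ⟨K₃, hK₃, hM⟩ := exists_le_twoPow hshort
  refine ⟨K₁ + K₂ + K₃, Eventually.frequently ?_⟩
  filter_upwards [eventually_ge_atTop 0] with u hu0
  set v := θ * u with hv
  have hv0 : 0 ≤ v := mul_nonneg hθ.1 hu0
  have hvu : v ≤ u := by nlinarith [hθ.2]
  obtain ⟨w₀, hw₀⟩ := hρ.cutWords_nonempty (v + c)
  have hw₀1 := hw₀.1
  have hw₀2 := hρ.le_of_mem_cutWords hw₀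
  rw [max_eq_left (by linarith)] at hw₀2
  have hsubΛ := hΛ.image_wordMap_subset w₀
  set p : Λ := ⟨wordMap f w₀ y₀, hsubΛ (mem_image_of_mem _ hy₀)⟩ with hp
  set N := (coverNum ((2 : ℝ) ^ (-u)) (Metric.ball p ((2 : ℝ) ^ (-v))) : ℝ≥0∞) with hNdef
  have hS : (coverNum ((2 : ℝ) ^ (-u)) (wordMap f w₀ '' Λ) : ℝ≥0∞) ≤ N := by
    refine ENat.toENNReal_le.2 (le_trans (coverNum_mono ?_) (coverNum_image_val_le _))
    rintro _ ⟨y, hy, rfl⟩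
    refine ⟨⟨wordMap f w₀ y, hsubΛ (mem_image_of_mem _ hy)⟩, ?_, rfl⟩
    rw [Metric.mem_ball, Subtype.dist_eq]
    calc dist (wordMap f w₀ y) (wordMap f w₀ y₀) ≤ C * (2 : ℝ) ^ (-ρ w₀) := hC _ _ _
      _ ≤ |C| * (2 : ℝ) ^ (-(v + c)) := mul_le_mul (le_abs_self _) (two_rpow_neg_le hw₀1)
          (two_rpow_neg_pos _).le (abs_nonneg _)
      _ < (|C| + 1) * (2 : ℝ) ^ (-(v + c)) := by
        have := two_rpow_neg_pos (v + c)
        linarith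
      _ = (2 : ℝ) ^ (-v) := by
        rw [← hc2, ← Real.rpow_add two_pos]
        congr 1
        ring
  obtain ⟨D, hD, hDe⟩ := exists_cover (two_rpow_neg_pos u) (wordMap f w₀ '' Λ)
  set I : X → Set (List ι) := fun x =>
    {q ∈ cutWords ρ (u - v) | wordMap f (w₀ ++ q) y₀ ∈ Metric.ball x ((2 : ℝ) ^ (-u))} with hI
  have hcover : cutWords ρ (u - v) ⊆ ⋃ x ∈ D, I x := fun q hq => by
    have h1 : wordMap f (w₀ ++ q) y₀ ∈ wordMap f w₀ '' Λ := by
      rw [wordMap_append]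
      exact mem_image_of_mem _ (hΛ.image_wordMap_subset q (mem_image_of_mem _ hy₀))
    obtain ⟨x, hx, hxy⟩ := mem_iUnion₂.1 (hD h1)
    exact mem_biUnion hx ⟨hq, hxy⟩
  have hIcard : ∀ x, ((I x).encard : ℝ≥0∞) ≤ twoPow (ε / 2 * u + K₂) * twoPow K₃ := fun x => by
    have h1 : (I x).encard ≤ {w | (u ≤ ρ w ∧ ρ w ≤ u + L) ∧
        (range (wordMap f w) ∩ Metric.ball x ((2 : ℝ) ^ (-u))).Nonempty}.encard := by
      refine encard_le_encard_of_injOn (f := fun q => w₀ ++ q) (fun q hq => ⟨⟨?_, ?_⟩, ?_⟩)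
        (fun q _ q' _ hqq => List.append_cancel_left hqq)
      · linarith [hρ.superadd w₀ q, hq.1.1]
      · have h2 := hρ.le_of_mem_cutWords hq.1
        rw [max_eq_left (by linarith)] at h2
        linarith [hρ.subadd w₀ q]
      · exact ⟨_, mem_range_self _, hq.2⟩
    refine (ENat.toENNReal_le.2 (h1.trans (hρ.encard_near_band_le x u L))).trans ?_
    rw [ENat.toENNReal_mul]
    have h2 := hnear x u
    rw [max_eq_left hu0] at h2
    gcongr
  have hcount : twoPow ((h - ε / 2) * (u - v) - K₁) ≤
      N * twoPow (ε / 2 * u + K₂ + K₃) := by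
    calc _ ≤ ((cutWords ρ (u - v)).ncard : ℝ≥0∞) := hN _ (sub_nonneg.2 hvu)
      _ = ((cutWords ρ (u - v)).encard : ℝ≥0∞) := by
        rw [← (hρ.finite_cutWords (u - v)).cast_ncard_eq, ENat.toENNReal_coe]
      _ = ∑' _ : cutWords ρ (u - v), (1 : ℝ≥0∞) := (ENNReal.tsum_set_one _).symm
      _ ≤ ∑' _ : ⋃ x ∈ D, I x, (1 : ℝ≥0∞) := ENNReal.tsum_mono_subtype (fun _ => 1) hcover
      _ ≤ ∑' x : D, ∑' _ : I x.1, (1 : ℝ≥0∞) :=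
        ENNReal.tsum_biUnion_le_tsum (fun _ => 1) D I
      _ ≤ ∑' _ : D, twoPow (ε / 2 * u + K₂) * twoPow K₃ := ENNReal.tsum_le_tsum fun x =>
        (ENNReal.tsum_set_one _).trans_le (hIcard x)
      _ = D.encard * (twoPow (ε / 2 * u + K₂) * twoPow K₃) := ENNReal.tsum_set_const _ _
      _ ≤ N * twoPow (ε / 2 * u + K₂ + K₃) := by
        rw [hDe, ← twoPow_add]
        gcongr
  have hfinal : twoPow ((h - ε / 2) * (u - v) - K₁ - (ε / 2 * u + K₂ + K₃)) ≤ N := by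
    rw [sub_eq_add_neg _ (ε / 2 * u + K₂ + K₃), twoPow_add]
    calc _ ≤ N * twoPow (ε / 2 * u + K₂ + K₃) * twoPow (-(ε / 2 * u + K₂ + K₃)) := by gcongr
      _ = N := by rw [mul_assoc, ← twoPow_add, add_neg_cancel, twoPow_zero, mul_one]
  refine (ENNReal.ofReal_le_ofReal ?_).trans (le_branching p hfinal)
  nlinarith

end Lower

/-! ### Spectra from approximate branching functions -/

section Approx

variable {E : Type*} [MetricSpace E] {α θ : ℝ} {ψ : ℝ → ℝ → ℝ}

theorem assouadSpectrum_le_upperAssouadSpectrum {s : ℝ} (hs : s ∈ Icc 0 θ) :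
    assouadSpectrum E s ≤ upperAssouadSpectrum E θ :=
  limsup_le_limsup (Eventually.of_forall fun u => le_iSup₂ (f := fun l (_ : l ∈ Icc (0 : ℝ) θ) =>
    branching E u (l * u) / ENNReal.ofReal (u * (1 - l))) s hs)

theorem HasApproxBranching.ofReal_psiQuot_le (h : HasApproxBranching E ψ) (hψ : IsBranching α ψ)
    (hθ : θ ∈ Ico (0 : ℝ) 1) :
    ENNReal.ofReal (PsiQuot (GammaLim ψ) θ) ≤ assouadSpectrum E θ := by
  obtain ⟨η, hη, happ⟩ := h
  have hθ' : θ ∈ Icc (0 : ℝ) 1 := ⟨hθ.1, hθ.2.le⟩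
  refine le_assouadSpectrum hθ.2 fun ε hε => ?_
  obtain ⟨K, hK, hηK⟩ := hη.exists_le (half_pos hε)
  refine ⟨K, ((hψ.frequently_gammaLim_le hθ' (half_pos hε)).and_eventually
    (eventually_ge_atTop 0)).mono fun u hu => ?_⟩
  obtain ⟨h1, hu0⟩ := hu
  have hm := mul_mem_of_angle hθ' hu0
  have h2 := (happ u (θ * u) hm.1 hm.2).2
  rw [← tsub_le_iff_right, ← ENNReal.ofReal_sub _ (hη.nonneg u hu0)] at h2
  refine (ENNReal.ofReal_le_ofReal ?_).trans h2
  have h3 := hηK u hu0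
  have h4 : PsiQuot (GammaLim ψ) θ * (u - θ * u) = GammaLim ψ θ * u := by
    rw [PsiQuot_of_lt _ hθ.2]
    have := (sub_pos.2 hθ.2).ne'
    field_simp
  linarith

/-- The upper Assouad spectrum, read off from an approximate branching function. -/
theorem HasApproxBranching.upperAssouadSpectrum_eq (h : HasApproxBranching E ψ)
    (hψ : IsBranching α ψ) (hθ : θ ∈ Ico (0 : ℝ) 1) :
    upperAssouadSpectrum E θ = ENNReal.ofReal (sSup (PsiQuot (GammaLim ψ) '' Icc 0 θ)) := by
  have hγ := hψ.isLimitFun_gammaLim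
  have hne : (PsiQuot (GammaLim ψ) '' Icc 0 θ).Nonempty := (nonempty_Icc.2 hθ.1).image _
  refine le_antisymm ?_ ?_
  · have hm0 : 0 ≤ sSup (PsiQuot (GammaLim ψ) '' Icc 0 θ) := by
      refine le_trans ?_ (hγ.psiQuot_le_sSup (left_mem_Icc.2 hθ.1) hθ.2)
      rw [PsiQuot_of_lt _ one_pos, sub_zero, div_one]
      exact hγ.nonneg 0 (left_mem_Icc.2 zero_le_one)
    set m := sSup (PsiQuot (GammaLim ψ) '' Icc 0 θ) with hm
    obtain ⟨η, hη, happ⟩ := h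
    refine ENNReal.le_of_forall_pos_le_add fun δ hδ _ => ?_
    rw [← ENNReal.ofReal_coe_nnreal, ← ENNReal.ofReal_add hm0 δ.coe_nonneg]
    have hθ1 := sub_pos.2 hθ.2
    set ε := (δ : ℝ) * (1 - θ) / 3 with hε
    have hε0 : 0 < ε := div_pos (mul_pos (NNReal.coe_pos.2 hδ) hθ1) three_pos
    obtain ⟨K, hK, hηK⟩ := hη.exists_le hε0
    refine limsup_le_of_le (by isBoundedDefault) ?_
    filter_upwards [hψ.eventually_forall_le_gammaLim hε0,
      eventually_add_le_mul (K := K) (by linarith : ε < 2 * ε), eventually_gt_atTop 0]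
      with u hu hKu hu0
    refine iSup₂_le fun s hs => ?_
    have hs1 : s < 1 := hs.2.trans_lt hθ.2
    have hs' : s ∈ Icc (0 : ℝ) 1 := ⟨hs.1, hs1.le⟩
    have hmem := mul_mem_of_angle hs' hu0.le
    refine ENNReal.div_le_of_le_mul (((happ u (s * u) hmem.1 hmem.2).1).trans ?_)
    rw [← ENNReal.ofReal_add (hψ.nonneg _ _ hmem.1 hmem.2) (hη.nonneg u hu0.le),
      ← ENNReal.ofReal_mul (add_nonneg hm0 δ.coe_nonneg)]
    refine ENNReal.ofReal_le_ofReal ?_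
    have h1 := hu s hs'
    have h2 := hηK u hu0.le
    have h3 := hγ.psiQuot_le_sSup hs hθ.2
    rw [PsiQuot_of_lt _ hs1, div_le_iff₀ (sub_pos.2 hs1), ← hm] at h3
    have h4 := mul_le_mul_of_nonneg_right h3 hu0.le
    have h5 : (δ : ℝ) * (1 - θ) * u ≤ δ * (1 - s) * u := by
      gcongr
      exact hs.2
    have h6 : 3 * ε = δ * (1 - θ) := by rw [hε]; ring
    rw [← h6] at h5
    linarith
  · rcases eq_or_ne (upperAssouadSpectrum E θ) ⊤ with htop | htop
    · rw [htop]
      exact le_top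
    · refine (ENNReal.ofReal_le_iff_le_toReal htop).2 (csSup_le hne ?_)
      rintro _ ⟨s, hs, rfl⟩
      exact (ENNReal.ofReal_le_iff_le_toReal htop).1 ((h.ofReal_psiQuot_le hψ
        ⟨hs.1, hs.2.trans_lt hθ.2⟩).trans (assouadSpectrum_le_upperAssouadSpectrum hs))

end Approx

/-! ### The Assouad spectrum of the inhomogeneous attractor -/

theorem assouadSpectrum_attractor_eq {X ι : Type*} [MetricSpace X] [CompactSpace X] [Finite ι]
    [Nonempty ι] {f : ι → X → X} {F Λ : Set X} {ρ : List ι → ℝ} {a b A h θ α : ℝ}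
    (hρ : WordWeight ρ a b A) (hf : MinimallyDistorting f F ρ) (hb : AsymptoticallyBounded f ρ)
    (hα : 0 ≤ α) (hX : quasiAssouadDim X = ENNReal.ofReal α) (hΛ : IsInhomAttractor f F Λ)
    (h0 : 0 ≤ h)
    (hh : Tendsto (fun u : ℝ => Real.logb 2 ((cutWords ρ u).ncard : ℝ) / u) atTop (𝓝 h))
    (hθ : θ ∈ Ico (0 : ℝ) 1) :
    assouadSpectrum Λ θ = max (ENNReal.ofReal h) (upperAssouadSpectrum F θ) := by
  refine le_antisymm ?_ (max_le (critical_exponent_le_assouadSpectrum hρ hf hb hΛ h0 hh hθ)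
    (upperAssouadSpectrum_le_assouadSpectrum hρ hf hΛ hθ))
  rcases eq_or_ne (upperAssouadSpectrum F θ) ⊤ with htop | htop
  · rw [htop, max_top_right]
    exact le_top
  set d := max h (upperAssouadSpectrum F θ).toReal with hd
  have hmax : max (ENNReal.ofReal h) (upperAssouadSpectrum F θ) = ENNReal.ofReal d := by
    rw [hd, ENNReal.ofReal_max, ENNReal.ofReal_toReal htop]
  rw [hmax]
  refine assouadSpectrum_le hθ.2 (h0.trans (le_max_left _ _)) fun ε hε => ?_
  have hF : upperAssouadSpectrum F θ ≤ ENNReal.ofReal d := hmax ▸ le_max_right _ _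
  obtain ⟨K, hK⟩ := branching_attractor_le hρ hf hb hα hX hΛ h0 hh hθ (le_max_left _ _) hF
    (ε := ε / 4) (by linarith)
  refine ⟨K, hK.mono fun u hu => ?_⟩
  rwa [mul_div_cancel₀ ε four_ne_zero] at hu

theorem theoremE :
    -- the maps between the function spaces
    (∀ α h : ℝ, 0 ≤ h → h ≤ α →
      -- the four maps of the diagram are well defined
      (∀ ψ, IsBranching α ψ → IsLimitFun α (GammaLim ψ)) ∧
      (∀ ψ, IsBranching α ψ → IsMonoBranching h α (PhiProj h ψ)) ∧
      (∀ ψ, IsMonoBranching h α ψ → IsMonoLimitFun h α (GammaLim ψ)) ∧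
      (∀ γ, IsLimitFun α γ → IsMonoLimitFun h α (OmegaProj h γ)) ∧
      -- `Ω_h γ` is the least element of the subspace that dominates `γ`
      (∀ γ, IsLimitFun α γ →
        (∀ θ ∈ Set.Icc (0 : ℝ) 1, γ θ ≤ OmegaProj h γ θ) ∧
        (∀ ξ, IsMonoLimitFun h α ξ → (∀ θ ∈ Set.Icc (0 : ℝ) 1, γ θ ≤ ξ θ) →
          ∀ θ ∈ Set.Icc (0 : ℝ) 1, OmegaProj h γ θ ≤ ξ θ)) ∧
      -- `Ω_h` is idempotent, the identity on the subspace, and surjective onto it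
      (∀ γ, IsLimitFun α γ →
        Set.EqOn (OmegaProj h (OmegaProj h γ)) (OmegaProj h γ) (Set.Icc 0 1)) ∧
      (∀ γ, IsMonoLimitFun h α γ → Set.EqOn (OmegaProj h γ) γ (Set.Icc 0 1)) ∧
      (∀ ξ, IsMonoLimitFun h α ξ →
        ∃ γ, IsLimitFun α γ ∧ Set.EqOn (OmegaProj h γ) ξ (Set.Icc 0 1)) ∧
      -- the restriction of `Γ` is surjective
      (∀ ξ, IsMonoLimitFun h α ξ →
        ∃ ψ, IsMonoBranching h α ψ ∧ Set.EqOn (GammaLim ψ) ξ (Set.Icc 0 1)) ∧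
      -- the diagram commutes
      (∀ ψ, IsBranching α ψ →
        Set.EqOn (GammaLim (PhiProj h ψ)) (OmegaProj h (GammaLim ψ)) (Set.Icc 0 1))) ∧
    -- the Assouad spectrum of the inhomogeneous attractor
    (∀ (X ι : Type*) [MetricSpace X] [CompactSpace X] [Finite ι] [Nonempty ι]
      (α : ℝ) (f : ι → X → X) (F Λ : Set X) (ρ : List ι → ℝ),
      0 ≤ α → quasiAssouadDim X = ENNReal.ofReal α →
      (∀ i, ∃ K : NNReal, ContractingWith K (f i)) →
      F.Nonempty → IsCompact F → IsInhomAttractor f F Λ →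
      MinimallyDistorting f F ρ → AsymptoticallyBounded f ρ →
      ∃ h : ℝ, IsCriticalExponent ρ h ∧ 0 ≤ h ∧ h ≤ α ∧
        ∀ θ ∈ Set.Ico (0 : ℝ) 1,
          assouadSpectrum Λ θ = max (ENNReal.ofReal h) (upperAssouadSpectrum F θ) ∧
          ∀ ψ, IsBranching α ψ → HasApproxBranching F ψ →
            assouadSpectrum Λ θ = ENNReal.ofReal (PsiQuot (GammaLim (PhiProj h ψ)) θ) ∧
            assouadSpectrum Λ θ = ENNReal.ofReal (PsiQuot (OmegaProj h (GammaLim ψ)) θ)) := by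
  refine ⟨fun α h h0 hα => ⟨fun ψ hψ => hψ.isLimitFun_gammaLim,
    fun ψ hψ => hψ.isMonoBranching_phiProj h0 hα,
    fun ψ hψ => hψ.isMonoLimitFun_gammaLim,
    fun γ hγ => hγ.isMonoLimitFun_omegaProj h0 hα,
    fun γ hγ => ⟨fun θ hθ => hγ.le_omegaProj hθ, fun ξ hξ H θ hθ => hξ.omegaProj_le H hθ⟩,
    fun γ hγ => (hγ.isMonoLimitFun_omegaProj h0 hα).omegaProj_eqOn,
    fun γ hγ => hγ.omegaProj_eqOn,
    fun ξ hξ => ⟨ξ, hξ.toIsLimitFun, hξ.omegaProj_eqOn⟩,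
    fun ξ hξ => ⟨_, hξ.isMonoBranching_homogeneous,
      fun θ _ => gammaLim_homogeneous ξ θ⟩,
    fun ψ hψ => hψ.gammaLim_phiProj_eqOn h0 hα⟩, ?_⟩
  intro X ι _ _ _ _ α f F Λ ρ hα hX _ hFne _ hΛ hf hb
  obtain ⟨a, b, A, hρ⟩ := hf.exists_wordWeight
  obtain ⟨h, h0, hh⟩ := hρ.exists_tendsto_logb_ncard
  have : Nonempty X := ⟨hFne.some⟩
  have hhα := hρ.critical_exponent_le h0 hh hb hα hX
  refine ⟨h, hh.congr' ?_, h0, hhα, fun θ hθ => ?_⟩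
  · filter_upwards [eventually_gt_atTop 0] with u hu
    rw [hρ.cutWords_eq_wordsAt hu]
  have hspec := assouadSpectrum_attractor_eq hρ hf hb hα hX hΛ h0 hh hθ
  refine ⟨hspec, fun ψ hψ happ => ?_⟩
  have h1 : assouadSpectrum Λ θ = ENNReal.ofReal (PsiQuot (OmegaProj h (GammaLim ψ)) θ) := by
    rw [hspec, happ.upperAssouadSpectrum_eq hψ hθ, PsiQuot_OmegaProj _ _ hθ.2, ENNReal.ofReal_max]
  refine ⟨?_, h1⟩
  rw [h1, PsiQuot_of_lt _ hθ.2, PsiQuot_of_lt _ hθ.2,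
    hψ.gammaLim_phiProj_eqOn h0 hhα ⟨hθ.1, hθ.2.le⟩]
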